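/- Let $N$ be a smooth Lorentzian $4$-manifold of signature $(+,+,+,-)$ and let $\Omega\subset N$ be a smooth spacelike hypersurface with boundary. Let $g_{ij}$ be the induced metric on $\Omega$, let $\tau$ be a smooth timelike unit normal field along $\Omega$, and let $p_{ij}$ be the second fundamental form of $\Omega$ in $N$ with respect to $\tau$, $p(u,v)=\langle\nabla_u\tau,v\rangle$. Let $f$ be a smooth function on $\Omega$ (or only on a neighbourhood $U$ of $\partial\Omega$ in $\Omega$) that solves Jang's equation with zero boundary values, $$\sum_{i,j=1}^3\Big(g^{ij}-\frac{f^if^j}{1+|\nabla f|^2}\Big)\Big(\frac{f_{ij}}{\sqrt{1+|\nabla f|^2}}-p_{ij}\Big)=0,\qquad f|_{\partial\Omega}=0 .$$ Let $\bar g_{ij}=g_{ij}+f_if_j$ be the metric of the graph of $f$ in $(\Omega\times\mathbb R,\ g_{ij}dx^idx^j+dt^2)$, let $\bar\nabla$ be the Levi-Civita connection of the product metric, let $\bar e_4$ be the downward unit normal of the graph, and extend $\bar e_4$ and $p_{ij}$ parallelly along the $\mathbb R$ factor. Let $X=\sum_{i=1}^3(h_{i4}-p_{i4})\bar e_i$,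 where $\bar e_1,\bar e_2,\bar e_3$ is an orthonormal frame of the graph, $h_{i4}=\langle\bar e_i,\bar\nabla_{\bar e_4}\bar e_4\rangle$ and $p_{i4}=p(\bar e_i,\bar e_4)$; regard $X$ as a vector field on $(\Omega,\bar g)$. Let $H$ and $\bar H$ be the mean curvatures of $\partial\Omega$ with respect to the outward unit normals $\nu$ in $(\Omega,g)$ and $\bar\nu$ in $(\Omega,\bar g)$, and let $P$ be the trace of the restriction of $p_{ij}$ to $\partial\Omega$. For null normals $l,n$ of $\partial\Omega$ in $N$ with $\langle l,n\rangle=-1$ and an orthonormal frame $e_1,e_2$ of $\partial\Omega$, let $$2\rho=-\langle\nabla_1e_1+\nabla_2e_2,\,l\rangle,\qquad -2\mu=-\langle\nabla_1e_1+\nabla_2e_2,\,n\rangle .$$ Then, at every point of $\partial\Omega$ at which $H>0$ and $\rho\mu>0$ (that is, the mean curvature vector of $\partial\Omega$ in $N$ is spacelike), $$H^2-P^2=8\rho\mu\qquad\text{and}\qquad \bar H-\langle X,\bar\nu\rangle\ \ge\ \sqrt{H^2-P^2}=\sqrt{8\rho\mu}.$$ -/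

import Mathlib

open Set Topology
open scoped Manifold ContDiff

noncomputable section

namespace JangBoundary

/-! ## Calculus of a metric on a set of a vector space

A (pseudo-)metric on a subset `s` of a vector space `V` (the range of a coordinate chart) is a field
`G` of bilinear forms. All derivatives are taken within `s`, so that boundary points are allowed. -/

section Coordinates

variable {V W : Type*} [NormedAddCommGroup V] [NormedSpace ℝ V]
  [NormedAddCommGroup W] [NormedSpace ℝ W]

/-- The vector dual to a covector `α` (index raising): `B (sharp B α) w = α w`. -/
def sharp (B : V →L[ℝ] V →L[ℝ] ℝ) (α : V →L[ℝ] ℝ) : V :=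
  ContinuousLinearMap.inverse B α

/-- The Levi-Civita derivative `∇_u v` of the vector field with constant components `v` (so
`Γ^k_{ij} u^i v^j`), given by the Koszul formula
`⟨Γ(u,v), w⟩ = (∂_u G(v,w) + ∂_v G(u,w) - ∂_w G(u,v)) / 2`. -/
def christoffel (G : V → V →L[ℝ] V →L[ℝ] ℝ) (s : Set V) (y u v : V) : V :=
  sharp (G y) ((1 / 2 : ℝ) •
    (fderivWithin ℝ G s y u v + fderivWithin ℝ G s y v u
      - ((fderivWithin ℝ G s y).flip u).flip v))

/-- The Levi-Civita covariant derivative `∇_u Y` of a vector field `Y`. -/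
def covDeriv (G : V → V →L[ℝ] V →L[ℝ] ℝ) (s : Set V) (Y : V → V) (y u : V) : V :=
  fderivWithin ℝ Y s y u + christoffel G s y u (Y y)

/-- For a map `F` from `s ⊆ W` into `V` with the metric `G` on `t ⊆ V`: the covariant derivative
`∇_u (dF v)` along `F`, where `v` is extended with constant components. -/
def covDerivAlong (G : V → V →L[ℝ] V →L[ℝ] ℝ) (t : Set V) (F : W → V) (s : Set W)
    (y u v : W) : V :=
  fderivWithin ℝ (fderivWithin ℝ F s) s y u v
    + christoffel G t (F y) (fderivWithin ℝ F s y u) (fderivWithin ℝ F s y v)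

/-- The gradient of `f`, with components `f^i = g^{ij} f_j`. -/
def grad (G : V → V →L[ℝ] V →L[ℝ] ℝ) (s : Set V) (f : V → ℝ) (y : V) : V :=
  sharp (G y) (fderivWithin ℝ f s y)

/-- `|∇f|² = G(∇f, ∇f)`. -/
def gradSq (G : V → V →L[ℝ] V →L[ℝ] ℝ) (s : Set V) (f : V → ℝ) (y : V) : ℝ :=
  G y (grad G s f y) (grad G s f y)

/-- The covariant Hessian `f_{ij} u^i v^j = ∂_u ∂_v f - df (∇_u v)`. -/
def hess (G : V → V →L[ℝ] V →L[ℝ] ℝ) (s : Set V) (f : V → ℝ) (y u v : V) : ℝ :=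
  fderivWithin ℝ (fderivWithin ℝ f s) s y u v - fderivWithin ℝ f s y (christoffel G s y u v)

/-- The metric `ḡ_{ij} = g_{ij} + f_i f_j` induced on the graph of `f`. -/
def graphMetric (G : V → V →L[ℝ] V →L[ℝ] ℝ) (s : Set V) (f : V → ℝ) (y : V) :
    V →L[ℝ] V →L[ℝ] ℝ :=
  G y + (ContinuousLinearMap.mul ℝ ℝ).bilinearComp (fderivWithin ℝ f s y) (fderivWithin ℝ f s y)

/-- The product metric `g_{ij} dx^i dx^j + dt²` on `s × ℝ`. -/
def productMetric (G : V → V →L[ℝ] V →L[ℝ] ℝ) (z : V × ℝ) :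
    (V × ℝ) →L[ℝ] (V × ℝ) →L[ℝ] ℝ :=
  (G z.1).bilinearComp (ContinuousLinearMap.fst ℝ V ℝ) (ContinuousLinearMap.fst ℝ V ℝ)
    + (ContinuousLinearMap.mul ℝ ℝ).bilinearComp
      (ContinuousLinearMap.snd ℝ V ℝ) (ContinuousLinearMap.snd ℝ V ℝ)

/-- The downward unit normal `e₄ = (∇f - ∂_t) / √(1 + |∇f|²)` of the graph of `f` in `s × ℝ`,
extended to all of `s × ℝ` by translations along `ℝ`. -/
def downNormal (G : V → V →L[ℝ] V →L[ℝ] ℝ) (s : Set V) (f : V → ℝ) (z : V × ℝ) : V × ℝ :=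
  (√(1 + gradSq G s f z.1))⁻¹ • (grad G s f z.1, (-1 : ℝ))

/-- The tangent vector `(v, df v)` of the graph of `f` over `v`. -/
def graphLift (s : Set V) (f : V → ℝ) (y v : V) : V × ℝ :=
  (v, fderivWithin ℝ f s y v)

/-- `h_{i4} = ⟨e_i, ∇̄_{e₄} e₄⟩` for the tangent vector `e_i` of the graph over `v`, where `∇̄` is the
Levi-Civita connection of the product metric on `s × ℝ`. -/
def hNormal (G : V → V →L[ℝ] V →L[ℝ] ℝ) (s : Set V) (f : V → ℝ) (y v : V) : ℝ :=
  productMetric G (y, f y)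
    (covDeriv (productMetric G) (s ×ˢ univ) (downNormal G s f) (y, f y)
      (downNormal G s f (y, f y)))
    (graphLift s f y v)

/-- `p_{i4} = p(e_i, e₄)`, where `p` is extended to `s × ℝ` parallelly along `ℝ`, so that
`p((v, a), (w, b)) = p(v, w)`. -/
def pNormal (G : V → V →L[ℝ] V →L[ℝ] ℝ) (s : Set V) (p : V → V → ℝ) (f : V → ℝ)
    (y v : V) : ℝ :=
  p (graphLift s f y v).1 (downNormal G s f (y, f y)).1

/-- The vector `X = ∑ (h_{i4} - p_{i4}) e_i`, for an orthonormal basis `b` of the tangent space with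
respect to the graph metric `ḡ` (`p` is the value of the tensor `p_{ij}` at `y`). -/
def jangVector (G : V → V →L[ℝ] V →L[ℝ] ℝ) (s : Set V) (p : V → V → ℝ) (f : V → ℝ) (y : V)
    {k : ℕ} (b : Fin k → V) : V :=
  ∑ i, (hNormal G s f y (b i) - pNormal G s p f y (b i)) • b i

/-- `e` is orthonormal for the bilinear form `B`. -/
def IsOrthonormalFor (B : V →L[ℝ] V →L[ℝ] ℝ) {k : ℕ} (e : Fin k → V) : Prop :=
  ∀ i j, B (e i) (e j) = if i = j then 1 else 0

/-- The expression, in the chart at `q`, of a field of bilinear forms on the tangent spaces of a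
manifold: its value at `y` is the pullback of the form by the derivative of the inverse chart. -/
def chartForm {H M : Type*} [TopologicalSpace H] (I : ModelWithCorners ℝ V H)
    [TopologicalSpace M] [ChartedSpace H M]
    (γ : (x : M) → TangentSpace I x →L[ℝ] TangentSpace I x →L[ℝ] ℝ) (q : M) (y : V) :
    V →L[ℝ] V →L[ℝ] ℝ :=
  let T : V →L[ℝ] V := mfderivWithin 𝓘(ℝ, V) I (extChartAt I q).symm (range I) y
  let B : V →L[ℝ] V →L[ℝ] ℝ := γ ((extChartAt I q).symm y)
  B.bilinearComp T T

end Coordinates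

/-! ## The spacetime and the hypersurface

`N` is a four dimensional manifold and `Ω` a three dimensional manifold with boundary. The tangent
space at a point `x` is the model vector space, a vector being given by its components in the
preferred chart at `x`. In the chart of `Ω` at a boundary point, `Ω` is the half space `y 0 ≥ 0`, so
a tangent vector `v` at that point is tangent to `∂Ω` if and only if `v 0 = 0`, and it points
strictly out of `Ω` if and only if `v 0 < 0`. -/

/-- The model vector space of `Ω`. -/
abbrev E3 := EuclideanSpace ℝ (Fin 3)

/-- The model vector space of `N`. -/
abbrev E4 := EuclideanSpace ℝ (Fin 4)

section Spacetime

variable {N : Type*} [TopologicalSpace N] [ChartedSpace E4 N]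

/-- A smooth pseudo-metric of signature `(+, +, +, -)` on a four dimensional manifold. -/
structure LorentzMetric (N : Type*) [TopologicalSpace N] [ChartedSpace E4 N]
    [IsManifold (𝓡 4) ∞ N] where
  /-- The scalar product on the tangent spaces. -/
  form (q : N) : TangentSpace (𝓡 4) q →L[ℝ] TangentSpace (𝓡 4) q →L[ℝ] ℝ
  signature (q : N) : ∃ b : Module.Basis (Fin 4) ℝ (TangentSpace (𝓡 4) q),
    ∀ i j, form q (b i) (b j) = if i = j then (if i = 3 then -1 else 1) else 0
  contMDiff : ContMDiff (𝓡 4) ((𝓡 4).prod 𝓘(ℝ, E4 →L[ℝ] E4 →L[ℝ] ℝ)) ∞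
    (fun q ↦ Bundle.TotalSpace.mk' (E4 →L[ℝ] E4 →L[ℝ] ℝ)
      (E := fun q : N ↦ TangentSpace (𝓡 4) q →L[ℝ] TangentSpace (𝓡 4) q →L[ℝ] ℝ) q (form q))

variable [IsManifold (𝓡 4) ∞ N]
variable {Ω : Type*} [TopologicalSpace Ω] [ChartedSpace (EuclideanHalfSpace 3) Ω]

/-- `ι` embeds `Ω` as a smooth spacelike hypersurface: the induced metric is positive definite (in
particular `ι` is an immersion). -/
structure IsSpacelikeHypersurface (γ : LorentzMetric N) (ι : Ω → N) : Prop where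
  contMDiff : ContMDiff (𝓡∂ 3) (𝓡 4) ∞ ι
  isEmbedding : IsEmbedding ι
  spacelike : ∀ (x : Ω) (v : TangentSpace (𝓡∂ 3) x), v ≠ 0 →
    0 < γ.form (ι x) (mfderiv (𝓡∂ 3) (𝓡 4) ι x v) (mfderiv (𝓡∂ 3) (𝓡 4) ι x v)

/-- `τ` is a smooth timelike unit normal field along the hypersurface. -/
structure IsTimelikeUnitNormal (γ : LorentzMetric N) (ι : Ω → N)
    (τ : (x : Ω) → TangentSpace (𝓡 4) (ι x)) : Prop where
  contMDiff : ContMDiff (𝓡∂ 3) (𝓡 4).tangent ∞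
    (fun x ↦ (⟨ι x, τ x⟩ : TangentBundle (𝓡 4) N))
  unit : ∀ x, γ.form (ι x) (τ x) (τ x) = -1
  normal : ∀ (x : Ω) (v : TangentSpace (𝓡∂ 3) x),
    γ.form (ι x) (τ x) (mfderiv (𝓡∂ 3) (𝓡 4) ι x v) = 0

/-- The range of the charts of `Ω`: the half space `y 0 ≥ 0`. -/
abbrev halfSpace : Set E3 := range (𝓡∂ 3)

/-- The coordinates of `x` in the chart at `x`. -/
def coord (x : Ω) : E3 := extChartAt (𝓡∂ 3) x x

/-- A function `f` in the chart at `x`. -/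
def localFun (f : Ω → ℝ) (x : Ω) : E3 → ℝ := f ∘ (extChartAt (𝓡∂ 3) x).symm

/-- The metric `γ` in the chart at `ι x`. -/
def localSpacetimeMetric (γ : LorentzMetric N) (ι : Ω → N) (x : Ω) : E4 → E4 →L[ℝ] E4 →L[ℝ] ℝ :=
  chartForm (𝓡 4) γ.form (ι x)

/-- The map `ι` in the charts at `x` and `ι x`. -/
def localEmb (ι : Ω → N) (x : Ω) : E3 → E4 := writtenInExtChartAt (𝓡∂ 3) (𝓡 4) x ι

/-- The induced metric `g = ι^* γ` of `Ω` in the chart at `x` (valid near `coord x`):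
`g_{ij} = γ_{αβ} ∂_i ι^α ∂_j ι^β`. -/
def localMetric (γ : LorentzMetric N) (ι : Ω → N) (x : Ω) (y : E3) : E3 →L[ℝ] E3 →L[ℝ] ℝ :=
  (localSpacetimeMetric γ ι x (localEmb ι x y)).bilinearComp
    (fderivWithin ℝ (localEmb ι x) halfSpace y) (fderivWithin ℝ (localEmb ι x) halfSpace y)

/-- The push-forward `dι v` of a tangent vector at `x`. -/
def push (ι : Ω → N) (x : Ω) (v : E3) : E4 :=
  fderivWithin ℝ (localEmb ι x) halfSpace (coord x) v

/-- The covariant derivative `∇_u v` in the spacetime of the vector field on `Ω` with constant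
components `v` in the chart at `x`. -/
def spacetimeDeriv (γ : LorentzMetric N) (ι : Ω → N) (x : Ω) (u v : E3) : E4 :=
  covDerivAlong (localSpacetimeMetric γ ι x) univ (localEmb ι x) halfSpace (coord x) u v

/-- The second fundamental form of `Ω` in `N` with respect to the unit normal `τ`:
`p(u, v) = ⟨∇_u τ, v⟩ = -⟨∇_u v, τ⟩`. -/
def secondForm (γ : LorentzMetric N) (ι : Ω → N) (τ : (x : Ω) → TangentSpace (𝓡 4) (ι x))
    (x : Ω) (u v : E3) : ℝ :=
  -γ.form (ι x) (spacetimeDeriv γ ι x u v) (τ x)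

/-- Jang's equation at the point `x`:
`∑_{i,j} (g^{ij} - f^i f^j / (1 + |∇f|²)) (f_{ij} / √(1 + |∇f|²) - p_{ij}) = 0`. -/
def JangEquationAt (γ : LorentzMetric N) (ι : Ω → N) (τ : (x : Ω) → TangentSpace (𝓡 4) (ι x))
    (f : Ω → ℝ) (x : Ω) : Prop :=
  let G := localMetric γ ι x
  let F := localFun f x
  let y := coord x
  let fUp := grad G halfSpace F y
  let W2 := 1 + gradSq G halfSpace F y
  let E : Fin 3 → E3 := fun i ↦ EuclideanSpace.single i 1
  let gInv : Fin 3 → Fin 3 → ℝ := fun i j ↦ sharp (G y) (EuclideanSpace.proj j) i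
  ∑ i, ∑ j, (gInv i j - fUp i * fUp j / W2) *
    (hess G halfSpace F y (E i) (E j) / √W2 - secondForm γ ι τ x (E i) (E j)) = 0

/-! ## The boundary of `Ω` -/

/-- `e` is an orthonormal frame, for the metric `B`, of the tangent plane of `∂Ω` at a boundary
point. -/
structure IsBoundaryFrame (B : E3 →L[ℝ] E3 →L[ℝ] ℝ) (e : Fin 2 → E3) : Prop where
  orthonormal : IsOrthonormalFor B e
  tangent : ∀ a, e a 0 = 0

/-- `ν` is the outward unit normal of `∂Ω`, for the metric `B`, at a boundary point. -/
structure IsOutwardUnitNormal (B : E3 →L[ℝ] E3 →L[ℝ] ℝ) (ν : E3) : Prop where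
  unit : B ν ν = 1
  normal : ∀ v : E3, v 0 = 0 → B ν v = 0
  outward : ν 0 < 0

/-- The mean curvature `∑_a ⟨∇_{e_a} ν, e_a⟩ = -∑_a ⟨∇_{e_a} e_a, ν⟩` of `∂Ω` at the point with
coordinates `y`, for the metric with components `G`, with respect to the unit normal `ν`. Here `e_a`
is extended with constant components, hence tangentially to `∂Ω`. -/
def boundaryMeanCurvature (G : E3 → E3 →L[ℝ] E3 →L[ℝ] ℝ) (y : E3) (e : Fin 2 → E3) (ν : E3) : ℝ :=
  -∑ a, G y (christoffel G halfSpace y (e a) (e a)) ν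

/-- `l, n` are null normals of `∂Ω` in the spacetime at `x`, with `⟨l, n⟩ = -1`. -/
structure IsNullNormalPair (γ : LorentzMetric N) (ι : Ω → N) (x : Ω)
    (l n : TangentSpace (𝓡 4) (ι x)) : Prop where
  null_l : γ.form (ι x) l l = 0
  null_n : γ.form (ι x) n n = 0
  pairing : γ.form (ι x) l n = -1
  normal_l : ∀ v : E3, v 0 = 0 → γ.form (ι x) l (push ι x v) = 0
  normal_n : ∀ v : E3, v 0 = 0 → γ.form (ι x) n (push ι x v) = 0

/-- `ρ`, defined by `2ρ = -⟨∇_1 e_1 + ∇_2 e_2, l⟩`. -/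
def nullRho (γ : LorentzMetric N) (ι : Ω → N) (x : Ω) (e : Fin 2 → E3)
    (l : TangentSpace (𝓡 4) (ι x)) : ℝ :=
  -(γ.form (ι x) (∑ a, spacetimeDeriv γ ι x (e a) (e a) : E4) l) / 2

/-- `μ`, defined by `-2μ = -⟨∇_1 e_1 + ∇_2 e_2, n⟩`. -/
def nullMu (γ : LorentzMetric N) (ι : Ω → N) (x : Ω) (e : Fin 2 → E3)
    (n : TangentSpace (𝓡 4) (ι x)) : ℝ :=
  γ.form (ι x) (∑ a, spacetimeDeriv γ ι x (e a) (e a) : E4) n / 2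

end Spacetime

end JangBoundary

end

open JangBoundary

/-! Since `f` vanishes on the boundary, `df = a⟨ν, ·⟩` there, with `a` the normal derivative. Put `r
= √(1 + a²)`. The metrics `g` and `ḡ` agree on vectors tangent to the boundary, and `ν̄ = ν / r`.
Second derivatives of `f` along the boundary vanish, so the Koszul formula gives `H̄ = H / r`, and
the tangential trace of the Hessian is `a H`. A computation with the normal of the graph
(`hNormal_apply`) gives `⟨X, ν̄⟩ = (a / r²)(f_νν / r - p_νν)`. Jang's equation at the point reads `a
H / r - P + (f_νν / r - p_νν) / r² = 0`. Eliminating the normal term leaves `H̄ - ⟨X, ν̄⟩ = r H - a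
P` (`boundaryMeanCurvature_graph_sub`). The inequality is then algebra: `(r H - a P)² - (H² - P²) =
(a H - r P)²` (`sqrt_sq_sub_sq_le`). The identity `H² - P² = 8ρμ` expresses the norm of the mean
curvature vector in two ways. Its components along `ν` and `τ` are `-H` and `-P` by the Gauss
formula (`koszul_pullback`) and the definition of `p`; the null pair `l, n` gives the other
expression (`sq_sub_sq_eq_of_null`). -/

noncomputable section

namespace JangBoundary

/-! ### Linear algebra of nondegenerate bilinear forms. -/

section LinearAlgebra

variable {V : Type*} [NormedAddCommGroup V] [NormedSpace ℝ V]

theorem apply_sharp {B : V →L[ℝ] V →L[ℝ] ℝ} (hB : B.IsInvertible) (α : V →L[ℝ] ℝ) :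
    B (sharp B α) = α :=
  hB.self_apply_inverse α

theorem sharp_add (B : V →L[ℝ] V →L[ℝ] ℝ) (α β : V →L[ℝ] ℝ) :
    sharp B (α + β) = sharp B α + sharp B β :=
  map_add _ _ _

theorem sharp_smul (B : V →L[ℝ] V →L[ℝ] ℝ) (c : ℝ) (α : V →L[ℝ] ℝ) :
    sharp B (c • α) = c • sharp B α :=
  map_smul _ _ _

variable [FiniteDimensional ℝ V]

/-- Expansion of a vector in a basis which is orthonormal, up to signs, for a bilinear form. -/
theorem sum_smul_eq_of_orthogonal {k : ℕ} {B : V →L[ℝ] V →L[ℝ] ℝ} {e : Fin k → V} {σ : Fin k → ℝ}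
    (hk : Module.finrank ℝ V = k) (hσ : ∀ i, σ i * σ i = 1)
    (he : ∀ i j, B (e i) (e j) = if i = j then σ i else 0) (v : V) :
    ∑ i, (σ i * B v (e i)) • e i = v := by
  have key : ∀ (c : Fin k → ℝ) (j : Fin k), B (∑ i, c i • e i) (e j) = c j * σ j := by
    intro c j
    simp [map_sum, he]
  have hli : LinearIndependent ℝ e := by
    rw [Fintype.linearIndependent_iff]
    intro c hc j
    have h := key c j
    rw [hc] at h
    have hj : σ j ≠ 0 := fun h0 ↦ by simpa [h0] using hσ j
    simpa [hj] using h.symm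
  have hsp : ⊤ ≤ Submodule.span ℝ (range e) :=
    (hli.span_eq_top_of_card_eq_finrank' (by simp [hk])).ge
  let b := Module.Basis.mk hli hsp
  have hv : ∑ i, b.repr v i • e i = v := by
    simpa [b] using b.sum_repr v
  conv_rhs => rw [← hv]
  refine Finset.sum_congr rfl fun i _ ↦ ?_
  congr 1
  conv_lhs => rw [← hv, key]
  linear_combination (b.repr v i) * hσ i

/-- An injective map from `V` to its dual is bijective by dimension. Invertibility matters because
`sharp` uses the total function `ContinuousLinearMap.inverse`, whose value is junk otherwise. -/
theorem isInvertible_of_separating {B : V →L[ℝ] V →L[ℝ] ℝ}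
    (h : ∀ v, (∀ w, B v w = 0) → v = 0) : B.IsInvertible := by
  have hinj : Function.Injective (B : V →ₗ[ℝ] V →L[ℝ] ℝ) := by
    rw [← LinearMap.ker_eq_bot, LinearMap.ker_eq_bot']
    intro v hv
    refine h v fun w ↦ ?_
    have : B v = 0 := hv
    simp [this]
  have hdim : Module.finrank ℝ V = Module.finrank ℝ (V →L[ℝ] ℝ) := by
    rw [← (LinearMap.toContinuousLinearMap (𝕜 := ℝ) (E := V) (F' := ℝ)).finrank_eq]
    exact (Subspace.dual_finrank_eq (K := ℝ) (V := V)).symm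
  refine ⟨(LinearMap.linearEquivOfInjective _ hinj hdim).toContinuousLinearEquiv, ?_⟩
  ext v w
  rfl

theorem isInvertible_of_orthogonal {k : ℕ} {B : V →L[ℝ] V →L[ℝ] ℝ}
    {e : Fin k → V} {σ : Fin k → ℝ}
    (hk : Module.finrank ℝ V = k) (hσ : ∀ i, σ i * σ i = 1)
    (he : ∀ i j, B (e i) (e j) = if i = j then σ i else 0) : B.IsInvertible := by
  refine isInvertible_of_separating fun v hv ↦ ?_
  rw [← sum_smul_eq_of_orthogonal hk hσ he v]
  simp [hv]

theorem isInvertible_of_pos {B : V →L[ℝ] V →L[ℝ] ℝ}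
    (h : ∀ v, v ≠ 0 → 0 < B v v) : B.IsInvertible := by
  refine isInvertible_of_separating fun v hv ↦ ?_
  by_contra h0
  exact (h v h0).ne' (hv v)

theorem IsOrthonormalFor.sum_smul_eq {k : ℕ} {B : V →L[ℝ] V →L[ℝ] ℝ} {e : Fin k → V}
    (he : IsOrthonormalFor B e) (hk : Module.finrank ℝ V = k) (v : V) :
    ∑ i, B v (e i) • e i = v := by
  simpa using sum_smul_eq_of_orthogonal (σ := fun _ ↦ 1) hk (by simp) he v

theorem sharp_eq_sum {k : ℕ} {B : V →L[ℝ] V →L[ℝ] ℝ} {e : Fin k → V} (hB : B.IsInvertible)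
    (he : IsOrthonormalFor B e) (hk : Module.finrank ℝ V = k) (α : V →L[ℝ] ℝ) :
    sharp B α = ∑ i, α (e i) • e i := by
  simpa [apply_sharp hB] using (he.sum_smul_eq hk (sharp B α)).symm

/-- The trace of a bilinear map is the same in all orthonormal frames. -/
theorem IsOrthonormalFor.sum_apply_eq {W : Type*} [AddCommGroup W] [Module ℝ W]
    {k : ℕ} {B : V →L[ℝ] V →L[ℝ] ℝ} {e e' : Fin k → V} (he : IsOrthonormalFor B e)
    (he' : IsOrthonormalFor B e') (hB : ∀ v w, B v w = B w v)
    (hk : Module.finrank ℝ V = k)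
    (T : V →ₗ[ℝ] V →ₗ[ℝ] W) : ∑ i, T (e i) (e i) = ∑ i, T (e' i) (e' i) := by
  have h1 : ∀ i, T (e i) (e i) = ∑ j, ∑ m, (B (e i) (e' j) * B (e i) (e' m)) • T (e' j) (e' m) := by
    intro i
    conv_lhs => rw [← he'.sum_smul_eq hk (e i)]
    simp only [map_sum, map_smul, LinearMap.sum_apply, LinearMap.smul_apply, Finset.smul_sum,
      smul_smul]
    rw [Finset.sum_comm]
    simp_rw [mul_comm]
  -- The change of basis is orthogonal: this is Parseval for `e' j` and `e' m` in the frame `e`.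
  have h2 : ∀ j m, ∑ i, B (e i) (e' j) * B (e i) (e' m) = if j = m then 1 else 0 := by
    intro j m
    rw [← he' j m]
    conv_rhs => rw [← he.sum_smul_eq hk (e' j)]
    simp [map_sum, hB (e' j)]
  simp_rw [h1]
  rw [Finset.sum_comm]
  refine Finset.sum_congr rfl fun j _ ↦ ?_
  rw [Finset.sum_comm]
  simp_rw [← Finset.sum_smul, h2]
  simp

end LinearAlgebra

/-! ### Derivatives of metrics and the Koszul formula. -/

section Calculus

variable {V W : Type*} [NormedAddCommGroup V] [NormedSpace ℝ V]
  [NormedAddCommGroup W] [NormedSpace ℝ W]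

/-- In finite dimension `L` is the finite sum of the terms `c i ⊗ L (b i)` over a basis `b` with
dual basis `c`, so differentiability may be tested on fixed vectors. -/
theorem differentiableWithinAt_clm_apply_iff [FiniteDimensional ℝ V] {E : Type*}
    [NormedAddCommGroup E] [NormedSpace ℝ E] {L : W → V →L[ℝ] E}
    {s : Set W} {y : W} :
    DifferentiableWithinAt ℝ L s y ↔ ∀ v, DifferentiableWithinAt ℝ (fun z ↦ L z v) s y := by
  refine ⟨fun h v ↦ h.clm_apply (differentiableWithinAt_const v), fun h ↦ ?_⟩
  let b := Module.finBasis ℝ V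
  let c : Fin (Module.finrank ℝ V) → V →L[ℝ] ℝ := fun i ↦ LinearMap.toContinuousLinearMap (b.coord i)
  have hL : L = fun z ↦ ∑ i, (c i).smulRight (L z (b i)) := by
    funext z
    ext v
    conv_lhs => rw [← b.sum_repr v, map_sum]
    simp only [map_smul]
    simp [c]
  rw [hL]
  exact DifferentiableWithinAt.fun_sum fun i _ ↦
    (ContinuousLinearMap.smulRightL ℝ V E (c i)).differentiableAt.comp_differentiableWithinAt y
      (h (b i))

theorem differentiableWithinAt_form_iff [FiniteDimensional ℝ V] {G : W → V →L[ℝ] V →L[ℝ] ℝ}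
    {s : Set W} {y : W} :
    DifferentiableWithinAt ℝ G s y ↔ ∀ v w, DifferentiableWithinAt ℝ (fun z ↦ G z v w) s y := by
  simp_rw [differentiableWithinAt_clm_apply_iff]

theorem fderivWithin_form_apply {G : W → V →L[ℝ] V →L[ℝ] ℝ} {s : Set W} {y : W}
    (hs : UniqueDiffWithinAt ℝ s y) (hG : DifferentiableWithinAt ℝ G s y) (u : W) (v w : V) :
    fderivWithin ℝ G s y u v w = fderivWithin ℝ (fun z ↦ G z v w) s y u := by
  have h := ((hG.hasFDerivWithinAt.clm_apply (hasFDerivWithinAt_const v y s)).clm_apply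
    (hasFDerivWithinAt_const w y s)).fderivWithin hs
  rw [h]
  simp

/-- The lowered Christoffel symbol `⟨Γ(u, v), w⟩`, given by the Koszul formula. -/
def koszul (G : V → V →L[ℝ] V →L[ℝ] ℝ) (s : Set V) (y u v w : V) : ℝ :=
  (1 / 2 : ℝ) * (fderivWithin ℝ G s y u v w + fderivWithin ℝ G s y v u w
    - fderivWithin ℝ G s y w u v)

variable {G : V → V →L[ℝ] V →L[ℝ] ℝ} {s : Set V} {y : V}

theorem apply_christoffel (hB : (G y).IsInvertible) (u v w : V) :
    G y (christoffel G s y u v) w = koszul G s y u v w := by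
  rw [christoffel, apply_sharp hB]
  simp [koszul]

theorem christoffel_add_left (u u' v : V) :
    christoffel G s y (u + u') v = christoffel G s y u v + christoffel G s y u' v := by
  rw [christoffel, christoffel, christoffel, ← sharp_add, ← smul_add]
  congr 2
  ext w
  simp
  ring

theorem christoffel_smul_left (c : ℝ) (u v : V) :
    christoffel G s y (c • u) v = c • christoffel G s y u v := by
  rw [christoffel, christoffel, ← sharp_smul, smul_comm c]
  congr 2
  ext w
  simp
  ring

theorem christoffel_add_right (u v v' : V) :
    christoffel G s y u (v + v') = christoffel G s y u v + christoffel G s y u v' := by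
  rw [christoffel, christoffel, christoffel, ← sharp_add, ← smul_add]
  congr 2
  ext w
  simp
  ring

theorem christoffel_smul_right (c : ℝ) (u v : V) :
    christoffel G s y u (c • v) = c • christoffel G s y u v := by
  rw [christoffel, christoffel, ← sharp_smul, smul_comm c]
  congr 2
  ext w
  simp
  ring

/-- `christoffel` as a bilinear map. -/
def christoffelLinear (G : V → V →L[ℝ] V →L[ℝ] ℝ) (s : Set V) (y : V) : V →ₗ[ℝ] V →ₗ[ℝ] V :=
  LinearMap.mk₂ ℝ (christoffel G s y) christoffel_add_left christoffel_smul_left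
    christoffel_add_right christoffel_smul_right

/-- `hess` as a bilinear map. -/
def hessLinear (G : V → V →L[ℝ] V →L[ℝ] ℝ) (s : Set V) (F : V → ℝ) (y : V) :
    V →ₗ[ℝ] V →ₗ[ℝ] ℝ :=
  LinearMap.mk₂ ℝ (hess G s F y)
    (fun u u' v ↦ by simp [hess, christoffel_add_left]; ring)
    (fun c u v ↦ by simp [hess, christoffel_smul_left]; ring)
    (fun u v v' ↦ by simp [hess, christoffel_add_right]; ring)
    (fun c u v ↦ by simp [hess, christoffel_smul_right]; ring)

/-! ### The gradient -/

/-- Inversion is smooth at an invertible operator, whence differentiability. The formula comes from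
differentiating `G(∇F, ·) = dF`, valid near `y` because invertibility is an open condition. -/
theorem fderivWithin_grad [FiniteDimensional ℝ V] {F : V → ℝ} (hs : UniqueDiffWithinAt ℝ s y)
    (hy : y ∈ s) (hG : DifferentiableWithinAt ℝ G s y)
    (hF : DifferentiableWithinAt ℝ (fderivWithin ℝ F s) s y) (hB : (G y).IsInvertible) :
    DifferentiableWithinAt ℝ (grad G s F) s y ∧ ∀ u v,
      G y (fderivWithin ℝ (grad G s F) s y u) v
        = fderivWithin ℝ (fderivWithin ℝ F s) s y u v
          - fderivWithin ℝ G s y u (grad G s F y) v := by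
  have : CompleteSpace V := FiniteDimensional.complete ℝ V
  obtain ⟨B, hB'⟩ := hB
  have hd : DifferentiableWithinAt ℝ (grad G s F) s y := by
    have h1 : DifferentiableAt ℝ (ContinuousLinearMap.inverse (R := ℝ) (M := V) (M₂ := V →L[ℝ] ℝ))
        (G y) := by
      rw [← hB']
      exact (contDiffAt_map_inverse (n := 1) B).differentiableAt one_ne_zero
    have h2 := DifferentiableAt.comp_differentiableWithinAt (𝕜 := ℝ) (E := V)
      (F := V →L[ℝ] V →L[ℝ] ℝ) (G := (V →L[ℝ] ℝ) →L[ℝ] V) (f := G)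
      (g := ContinuousLinearMap.inverse) y h1 hG
    exact DifferentiableWithinAt.clm_apply (c := fun z ↦ (G z).inverse) h2 hF
  have hev : (fun z ↦ G z (grad G s F z)) =ᶠ[𝓝[s] y] fderivWithin ℝ F s := by
    have h1 : range ((↑) : (V ≃L[ℝ] (V →L[ℝ] ℝ)) → V →L[ℝ] V →L[ℝ] ℝ) ∈ 𝓝 (G y) := by
      rw [← hB']
      exact ContinuousLinearEquiv.nhds B
    filter_upwards [hG.continuousWithinAt h1] with z hz
    exact apply_sharp (B := G z) hz _
  refine ⟨hd, fun u v ↦ ?_⟩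
  have h2 := fderivWithin_clm_apply hs hG hd
  rw [hev.fderivWithin_eq (hev.self_of_nhdsWithin hy)] at h2
  rw [h2]
  simp

/-- The hypothesis `dF = a⟨ν, ·⟩` is the situation at a boundary point when `F` vanishes on the
boundary. -/
theorem grad_eq_of_fderivWithin_eq {F : V → ℝ} {a : ℝ} {ν : V} (hB : (G y).IsInvertible)
    (h : fderivWithin ℝ F s y = a • G y ν) : grad G s F y = a • ν := by
  rw [grad, h, sharp_smul, sharp, hB.inverse_apply_self]

theorem gradSq_eq_of_fderivWithin_eq {F : V → ℝ} {a : ℝ} {ν : V} (hB : (G y).IsInvertible)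
    (hν : G y ν ν = 1) (h : fderivWithin ℝ F s y = a • G y ν) : gradSq G s F y = a ^ 2 := by
  rw [gradSq, grad_eq_of_fderivWithin_eq hB h]
  simp [hν]
  ring

/-! ### The product metric and the normal of the graph -/

theorem productMetric_apply (z u v : V × ℝ) :
    productMetric G z u v = G z.1 u.1 v.1 + u.2 * v.2 := by
  simp [productMetric]

theorem uniqueDiffWithinAt_prod_univ (hs : UniqueDiffWithinAt ℝ s y) (t : ℝ) :
    UniqueDiffWithinAt ℝ (s ×ˢ (univ : Set ℝ)) (y, t) :=
  hs.prod uniqueDiffWithinAt_univ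

theorem hasFDerivWithinAt_comp_fst {φ : V → W} (hφ : DifferentiableWithinAt ℝ φ s y) (t : ℝ) :
    HasFDerivWithinAt (fun z : V × ℝ ↦ φ z.1)
      ((fderivWithin ℝ φ s y).comp (ContinuousLinearMap.fst ℝ V ℝ)) (s ×ˢ univ) (y, t) :=
  HasFDerivWithinAt.comp (g := φ) (t := s) (y, t) hφ.hasFDerivWithinAt
    (hasFDerivWithinAt_fst) (fun _ hz ↦ hz.1)

theorem differentiableWithinAt_productMetric [FiniteDimensional ℝ V]
    (hG : DifferentiableWithinAt ℝ G s y) (t : ℝ) :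
    DifferentiableWithinAt ℝ (productMetric G) (s ×ˢ univ) (y, t) := by
  rw [differentiableWithinAt_form_iff]
  intro v w
  simp_rw [productMetric_apply]
  exact (((hasFDerivWithinAt_comp_fst hG t).differentiableWithinAt.clm_apply
    (differentiableWithinAt_const v.1)).clm_apply (differentiableWithinAt_const w.1)).add_const _

theorem fderivWithin_productMetric [FiniteDimensional ℝ V] (hs : UniqueDiffWithinAt ℝ s y)
    (hG : DifferentiableWithinAt ℝ G s y) (t : ℝ) (u v w : V × ℝ) :
    fderivWithin ℝ (productMetric G) (s ×ˢ univ) (y, t) u v w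
      = fderivWithin ℝ G s y u.1 v.1 w.1 := by
  rw [fderivWithin_form_apply (uniqueDiffWithinAt_prod_univ hs t)
    (differentiableWithinAt_productMetric hG t)]
  simp_rw [productMetric_apply]
  have h := ((((hasFDerivWithinAt_comp_fst hG t).clm_apply
    (hasFDerivWithinAt_const v.1 _ _)).clm_apply (hasFDerivWithinAt_const w.1 _ _)).add_const
      (v.2 * w.2)).fderivWithin (uniqueDiffWithinAt_prod_univ hs t)
  rw [h]
  simp

theorem koszul_productMetric [FiniteDimensional ℝ V] (hs : UniqueDiffWithinAt ℝ s y)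
    (hG : DifferentiableWithinAt ℝ G s y) (t : ℝ) (u v w : V × ℝ) :
    koszul (productMetric G) (s ×ˢ univ) (y, t) u v w = koszul G s y u.1 v.1 w.1 := by
  simp only [koszul, fderivWithin_productMetric hs hG]

theorem isInvertible_productMetric [FiniteDimensional ℝ V] (hB : (G y).IsInvertible) (t : ℝ) :
    (productMetric G (y, t)).IsInvertible := by
  refine isInvertible_of_separating fun v hv ↦ Prod.ext ?_ ?_
  · refine hB.injective ?_
    ext w
    simpa [productMetric_apply] using hv (w, 0)
  · simpa [productMetric_apply] using hv (0, 1)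

/-- Here `e₄ = w(aν, -1)`, and the tangent vector over `wν` is `w(ν, a)`. The derivative of the
normalizing factor multiplies `(aν, -1)`, which is orthogonal to the graph, and nothing depends on
`t`. What remains is `w` times the derivative of `∇F` along `w a ν`, paired with `wν`; the
connection terms complete it to the Hessian. -/
theorem hNormal_apply [FiniteDimensional ℝ V] {F : V → ℝ} {a : ℝ} {ν : V}
    (hs : UniqueDiffWithinAt ℝ s y) (hy : y ∈ s) (hG : DifferentiableWithinAt ℝ G s y)
    (hF : DifferentiableWithinAt ℝ (fderivWithin ℝ F s) s y) (hB : (G y).IsInvertible)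
    (hsymm : ∀ u v, G y u v = G y v u)
    (hν : G y ν ν = 1) (h : fderivWithin ℝ F s y = a • G y ν) :
    hNormal G s F y ((√(1 + a ^ 2))⁻¹ • ν) = a * (√(1 + a ^ 2))⁻¹ ^ 3 * hess G s F y ν ν := by
  set w : ℝ := (√(1 + a ^ 2))⁻¹ with hw
  let W : V → ℝ := fun z ↦ (√(1 + gradSq G s F z))⁻¹
  have hgr := grad_eq_of_fderivWithin_eq hB h
  have hsq := gradSq_eq_of_fderivWithin_eq hB hν h
  have hWy : W y = w := by simp only [W, hsq, hw]
  obtain ⟨hgd, hgd'⟩ := fderivWithin_grad hs hy hG hF hB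
  have hpos : 0 < 1 + gradSq G s F y := by rw [hsq]; positivity
  have hW : DifferentiableWithinAt ℝ W s y :=
    ((((hG.clm_apply hgd).clm_apply hgd).const_add 1).sqrt hpos.ne').inv
      (Real.sqrt_pos.2 hpos).ne'
  have hN : downNormal G s F = fun z ↦ (W z.1 • grad G s F z.1, -W z.1) := by
    funext z
    simp [downNormal, W]
  have hNd := ((hasFDerivWithinAt_comp_fst (hW.smul hgd) (F y)).prodMk
    (hasFDerivWithinAt_comp_fst hW.neg (F y))).fderivWithin (uniqueDiffWithinAt_prod_univ hs (F y))
  have hfs : fderivWithin ℝ (fun z ↦ W z • grad G s F z) s y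
      = W y • fderivWithin ℝ (grad G s F) s y
        + (fderivWithin ℝ W s y).smulRight (grad G s F y) := fderivWithin_fun_smul hs hW hgd
  have hfn : fderivWithin ℝ (-W) s y = -fderivWithin ℝ W s y := fderivWithin_neg hs
  -- With all three arguments equal to `ν`, the Koszul expression is half a single derivative of
  -- `G`.
  have hk : hess G s F y ν ν = fderivWithin ℝ (fderivWithin ℝ F s) s y ν ν
      - a * (1 / 2 * fderivWithin ℝ G s y ν ν ν) := by
    rw [hess, h, smul_apply, hsymm ν, apply_christoffel hB, koszul]
    simp
  rw [hNormal, covDeriv, map_add, add_apply,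
    apply_christoffel (isInvertible_productMetric hB _), koszul_productMetric hs hG,
    productMetric_apply, hN]
  erw [hNd]
  have h1 := hgd' ν ν
  rw [hgr] at h1
  rw [hk]
  simp only [ContinuousLinearMap.prod_apply, ContinuousLinearMap.comp_apply,
    ContinuousLinearMap.coe_fst', graphLift, h, hWy, hgr, koszul]
  erw [hfs]
  simp [hWy, hgr, hν, h1, hfn]
  ring

/-! ### The metric of the graph -/

theorem graphMetric_apply {F : V → ℝ} (z u v : V) :
    graphMetric G s F z u v = G z u v + fderivWithin ℝ F s z u * fderivWithin ℝ F s z v := by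
  simp [graphMetric]

theorem differentiableWithinAt_graphMetric [FiniteDimensional ℝ V] {F : V → ℝ}
    (hG : DifferentiableWithinAt ℝ G s y)
    (hF : DifferentiableWithinAt ℝ (fderivWithin ℝ F s) s y) :
    DifferentiableWithinAt ℝ (graphMetric G s F) s y := by
  rw [differentiableWithinAt_form_iff] at hG ⊢
  rw [differentiableWithinAt_clm_apply_iff] at hF
  intro v w
  simp_rw [graphMetric_apply]
  exact (hG v w).add ((hF v).mul (hF w))

theorem fderivWithin_graphMetric [FiniteDimensional ℝ V] {F : V → ℝ}
    (hs : UniqueDiffWithinAt ℝ s y) (hG : DifferentiableWithinAt ℝ G s y)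
    (hF : DifferentiableWithinAt ℝ (fderivWithin ℝ F s) s y) (u v w : V) :
    fderivWithin ℝ (graphMetric G s F) s y u v w = fderivWithin ℝ G s y u v w
      + (fderivWithin ℝ (fderivWithin ℝ F s) s y u v * fderivWithin ℝ F s y w
        + fderivWithin ℝ F s y v * fderivWithin ℝ (fderivWithin ℝ F s) s y u w) := by
  rw [fderivWithin_form_apply hs (differentiableWithinAt_graphMetric hG hF)]
  simp_rw [graphMetric_apply]
  have hv := hF.hasFDerivWithinAt.clm_apply (hasFDerivWithinAt_const v y s)
  have hw := hF.hasFDerivWithinAt.clm_apply (hasFDerivWithinAt_const w y s)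
  have h := ((hG.hasFDerivWithinAt.clm_apply (hasFDerivWithinAt_const v y s)).clm_apply
    (hasFDerivWithinAt_const w y s)).add (hv.mul hw)
  erw [h.fderivWithin hs]
  simp
  ring

/-- Every term added by `dF ⊗ dF` contains a factor `dF u` or `∂²F(u, u)`. Hence `g` and `ḡ` give
the boundary the same lowered symbols. -/
theorem koszul_graphMetric [FiniteDimensional ℝ V] {F : V → ℝ}
    (hs : UniqueDiffWithinAt ℝ s y) (hG : DifferentiableWithinAt ℝ G s y)
    (hF : DifferentiableWithinAt ℝ (fderivWithin ℝ F s) s y) {u : V} (v : V)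
    (hu : fderivWithin ℝ F s y u = 0)
    (huu : fderivWithin ℝ (fderivWithin ℝ F s) s y u u = 0) :
    koszul (graphMetric G s F) s y u u v = koszul G s y u u v := by
  simp [koszul, fderivWithin_graphMetric hs hG hF, hu, huu]

/-! ### Submanifolds -/

/-- The tangential part of the covariant derivative along an immersion is the covariant derivative
of the induced metric. -/
theorem koszul_pullback [FiniteDimensional ℝ V] [FiniteDimensional ℝ W]
    {A : W → W →L[ℝ] W →L[ℝ] ℝ} {φ : V → W}
    (hs : UniqueDiffWithinAt ℝ s y)
    (hA : DifferentiableAt ℝ A (φ y)) (hAs : ∀ z u v, A z u v = A z v u)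
    (hAi : (A (φ y)).IsInvertible) (hφ : DifferentiableWithinAt ℝ φ s y)
    (hφ' : DifferentiableWithinAt ℝ (fderivWithin ℝ φ s) s y)
    (hsymm : IsSymmSndFDerivWithinAt ℝ φ s y) (u v w : V) :
    DifferentiableWithinAt ℝ
      (fun z ↦ (A (φ z)).bilinearComp (fderivWithin ℝ φ s z) (fderivWithin ℝ φ s z)) s y ∧
    koszul (fun z ↦ (A (φ z)).bilinearComp (fderivWithin ℝ φ s z) (fderivWithin ℝ φ s z)) s y u v w
      = A (φ y) (covDerivAlong A univ φ s y u v) (fderivWithin ℝ φ s y w) := by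
  have hAφ : HasFDerivWithinAt (fun z ↦ A (φ z)) ((fderiv ℝ A (φ y)).comp (fderivWithin ℝ φ s y))
      s y :=
    HasFDerivAt.comp_hasFDerivWithinAt (𝕜 := ℝ) (F := W) (G := W →L[ℝ] W →L[ℝ] ℝ) (g := A) (f := φ)
      y hA.hasFDerivAt hφ.hasFDerivWithinAt
  have hφv : ∀ v, HasFDerivWithinAt (fun z ↦ fderivWithin ℝ φ s z v)
      ((fderivWithin ℝ (fderivWithin ℝ φ s) s y).flip v) s y := fun v ↦ by
    simpa using hφ'.hasFDerivWithinAt.clm_apply (hasFDerivWithinAt_const v y s)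
  have hD := fun v w ↦ (hAφ.clm_apply (hφv v)).clm_apply (hφv w)
  have hd : DifferentiableWithinAt ℝ
      (fun z ↦ (A (φ z)).bilinearComp (fderivWithin ℝ φ s z) (fderivWithin ℝ φ s z)) s y := by
    rw [differentiableWithinAt_form_iff]
    intro v w
    exact (hD v w).differentiableWithinAt
  have hD' : ∀ u v w, fderivWithin ℝ
      (fun z ↦ (A (φ z)).bilinearComp (fderivWithin ℝ φ s z) (fderivWithin ℝ φ s z)) s y u v w
      = A (φ y) (fderivWithin ℝ φ s y v) (fderivWithin ℝ (fderivWithin ℝ φ s) s y u w)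
        + (fderiv ℝ A (φ y) (fderivWithin ℝ φ s y u) (fderivWithin ℝ φ s y v)
            (fderivWithin ℝ φ s y w)
          + A (φ y) (fderivWithin ℝ (fderivWithin ℝ φ s) s y u v) (fderivWithin ℝ φ s y w)) := by
    intro u v w
    rw [fderivWithin_form_apply hs hd]
    simp only [ContinuousLinearMap.bilinearComp_apply]
    rw [(hD v w).fderivWithin hs]
    simp
    ring
  refine ⟨hd, ?_⟩
  rw [covDerivAlong, map_add, add_apply, apply_christoffel hAi, koszul, koszul, hD', hD', hD']
  simp only [fderivWithin_univ]
  -- By symmetry of `D²φ` and of `A`, all second-derivative terms cancel except the two equal ones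
  -- pairing `D²φ(u, v)` with `dφ w`.
  rw [hsymm v u, hsymm w u, hsymm w v,
    hAs _ (fderivWithin ℝ φ s y u) (fderivWithin ℝ (fderivWithin ℝ φ s) s y v w),
    hAs _ (fderivWithin ℝ φ s y v) (fderivWithin ℝ (fderivWithin ℝ φ s) s y u w)]
  ring

end Calculus

/-! ### Bilinear forms read in a chart. -/

section Charts

variable {V H M : Type*} [NormedAddCommGroup V] [NormedSpace ℝ V] [TopologicalSpace H]
  {I : ModelWithCorners ℝ V H} [TopologicalSpace M] [ChartedSpace H M]

theorem chartForm_symm {γ : (x : M) → TangentSpace I x →L[ℝ] TangentSpace I x →L[ℝ] ℝ}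
    (h : ∀ x u v, γ x u v = γ x v u) (q : M) (y u v : V) :
    chartForm I γ q y u v = chartForm I γ q y v u := by
  simp only [chartForm]
  exact h _ _ _

/-- In the chart at `q`, a field of bilinear forms has at the point `q` its own value. -/
theorem chartForm_self [IsManifold I 1 M]
    (γ : (x : M) → TangentSpace I x →L[ℝ] TangentSpace I x →L[ℝ] ℝ) (q : M) (u v : V) :
    chartForm I γ q (extChartAt I q q) u v = γ q u v := by
  have hT : (mfderivWithin 𝓘(ℝ, V) I (extChartAt I q).symm (range I) (extChartAt I q q) :
      V →L[ℝ] V) = fderivWithin ℝ (extChartAt I ((extChartAt I q).symm (extChartAt I q q)) ∘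
        (extChartAt I q).symm) (range I) (extChartAt I q q) := by
    have hd : MDifferentiableWithinAt 𝓘(ℝ, V) I (extChartAt I q).symm (range I)
        (extChartAt I q q) :=
      mdifferentiableWithinAt_extChartAt_symm (mem_extChartAt_target q)
    refine hd.mfderivWithin.trans ?_
    simp [writtenInExtChartAt, extChartAt_model_space_eq_id, -extChartAt, Function.comp_def]
    rfl
  -- The chart sends `q` back to `q` only propositionally and the type of `γ q'` depends on `q'`, so
  -- the point is generalized before substituting.
  have key : ∀ q' : M, q' = q →
      γ q' (fderivWithin ℝ (extChartAt I q' ∘ (extChartAt I q).symm) (range I) (extChartAt I q q) u)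
        (fderivWithin ℝ (extChartAt I q' ∘ (extChartAt I q).symm) (range I) (extChartAt I q q) v)
        = γ q u v := by
    intro q' hq'
    subst hq'
    have h1 : (extChartAt I q' ∘ (extChartAt I q').symm) =ᶠ[𝓝[range I] (extChartAt I q' q')]
        id := by
      filter_upwards [extChartAt_target_mem_nhdsWithin (I := I) q'] with z hz
      exact (extChartAt I q').right_inv hz
    have h2 := h1.fderivWithin_eq (𝕜 := ℝ) ((extChartAt I q').right_inv (mem_extChartAt_target q'))
    have h3 : fderivWithin ℝ id (range I) (extChartAt I q' q') = .id ℝ V :=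
      fderivWithin_id (I.uniqueDiffOn _ (mem_range_self _))
    rw [h2, h3]
    rfl
  rw [← key _ (extChartAt_to_inv (I := I) q), ← hT]
  rfl

end Charts

theorem localEmb_coord {N Ω : Type*} [TopologicalSpace N] [ChartedSpace E4 N] [TopologicalSpace Ω]
    [ChartedSpace (EuclideanHalfSpace 3) Ω] {ι : Ω → N} (x : Ω) :
    localEmb ι x (coord x) = extChartAt (𝓡 4) (ι x) (ι x) := by
  simp [localEmb, coord, writtenInExtChartAt, extChartAt_to_inv, -extChartAt]

/-! ### The spacetime and the hypersurface in coordinates. -/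

section Bridge

variable {N : Type*} [TopologicalSpace N] [ChartedSpace E4 N] [IsManifold (𝓡 4) ∞ N]

/-- Symmetry is forced by the signature condition: the form is diagonal in some basis. -/
theorem LorentzMetric.form_symm (γ : LorentzMetric N) (q : N) (u v : TangentSpace (𝓡 4) q) :
    γ.form q u v = γ.form q v u := by
  obtain ⟨b, hb⟩ := γ.signature q
  rw [← b.sum_repr u, ← b.sum_repr v]
  simp only [map_sum, map_smul, sum_apply, smul_apply, hb, smul_eq_mul]
  refine Finset.sum_congr rfl fun i _ ↦ ?_
  simp
  split_ifs <;> ring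

/-- Each coefficient is the smooth section `γ` evaluated on two coordinate vector fields, which are
smooth sections of the tangent bundle. -/
theorem LorentzMetric.differentiableAt_chartForm (γ : LorentzMetric N) (q : N) :
    DifferentiableAt ℝ (chartForm (𝓡 4) γ.form q) (extChartAt (𝓡 4) q q) := by
  have : IsManifold (𝓡 4) 1 N := IsManifold.of_le (n := ∞) (by norm_num)
  set φ := (extChartAt (𝓡 4) q) with hφ
  have hopen : IsOpen φ.target := isOpen_extChartAt_target q
  have hmem : φ q ∈ φ.target := mem_extChartAt_target q
  have hsymm : ContMDiffOn 𝓘(ℝ, E4) (𝓡 4) ∞ φ.symm φ.target := contMDiffOn_extChartAt_symm q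
  have htan := hsymm.contMDiffOn_tangentMapWithin (m := 1) (by norm_cast) hopen.uniqueMDiffOn
  rw [← differentiableWithinAt_univ, differentiableWithinAt_form_iff]
  intro v w
  rw [differentiableWithinAt_univ]
  have hsec : ∀ v : E4, ContMDiffWithinAt 𝓘(ℝ, E4) (𝓡 4).tangent 1
      (fun y : E4 ↦ Bundle.TotalSpace.mk' E4 (E := fun q : N ↦ TangentSpace (𝓡 4) q) (φ.symm y)
        (mfderivWithin 𝓘(ℝ, E4) (𝓡 4) φ.symm (range (𝓡 4)) y v)) φ.target (φ q) := by
    intro v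
    have hc : ContMDiff 𝓘(ℝ, E4) 𝓘(ℝ, E4).tangent 1
        (fun y : E4 ↦ (⟨y, v⟩ : TangentBundle 𝓘(ℝ, E4) E4)) := by
      exact contMDiff_vectorSpace_iff_contDiff.2 contDiff_const
    have h1 := ContMDiffWithinAt.comp (s := φ.target) (f := fun y : E4 ↦
      (⟨y, v⟩ : TangentBundle 𝓘(ℝ, E4) E4)) (φ q)
      (htan (⟨φ q, v⟩ : TangentBundle 𝓘(ℝ, E4) E4) hmem) (hc _).contMDiffWithinAt (fun y hy ↦ hy)
    have h2 : ∀ y ∈ φ.target, mfderivWithin 𝓘(ℝ, E4) (𝓡 4) φ.symm (range (𝓡 4)) y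
        = mfderivWithin 𝓘(ℝ, E4) (𝓡 4) φ.symm φ.target y := by
      intro y hy
      rw [mfderivWithin_of_mem_nhds (hopen.mem_nhds hy), (𝓡 4).range_eq_univ, mfderivWithin_univ]
    refine h1.congr (fun y hy ↦ ?_) ?_
    · rw [h2 y hy]; rfl
    · rw [h2 _ hmem]; rfl
  have hγ : ContMDiffWithinAt 𝓘(ℝ, E4) ((𝓡 4).prod 𝓘(ℝ, E4 →L[ℝ] E4 →L[ℝ] ℝ)) 1
      (fun y ↦ Bundle.TotalSpace.mk' (E4 →L[ℝ] E4 →L[ℝ] ℝ)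
        (E := fun q : N ↦ TangentSpace (𝓡 4) q →L[ℝ] TangentSpace (𝓡 4) q →L[ℝ] ℝ) (φ.symm y)
          (γ.form (φ.symm y))) φ.target (φ q) :=
    ((γ.contMDiff.of_le (by norm_num)).contMDiffAt).comp_contMDiffWithinAt (φ q)
      ((hsymm _ hmem).of_le (by norm_num))
  have h3 : ContMDiffWithinAt 𝓘(ℝ, E4) ((𝓡 4).prod 𝓘(ℝ)) 1
      (fun y ↦ Bundle.TotalSpace.mk' ℝ (E := Bundle.Trivial N ℝ) (φ.symm y)
        (chartForm (𝓡 4) γ.form q y v w)) φ.target (φ q) := by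
    apply ContMDiffWithinAt.clm_bundle_apply₂ (F₁ := E4) (F₂ := E4)
    · exact hγ
    · exact hsec v
    · exact hsec w
  simp only [Bundle.contMDiffWithinAt_totalSpace] at h3
  have h4 := h3.2.contDiffWithinAt.differentiableWithinAt one_ne_zero
  exact h4.differentiableAt (hopen.mem_nhds hmem)

theorem localSpacetimeMetric_symm {Ω : Type*} {γ : LorentzMetric N} {ι : Ω → N} (x : Ω)
    (z u v : E4) : localSpacetimeMetric γ ι x z u v = localSpacetimeMetric γ ι x z v u :=
  chartForm_symm γ.form_symm _ _ _ _

/-- The spacetime scalar product at `ι x`, on the model space. -/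
def spacetimeForm {Ω : Type*} (γ : LorentzMetric N) (ι : Ω → N) (x : Ω) : E4 →L[ℝ] E4 →L[ℝ] ℝ :=
  γ.form (ι x)

variable {Ω : Type*} [TopologicalSpace Ω] [ChartedSpace (EuclideanHalfSpace 3) Ω]

theorem uniqueDiffOn_halfSpace : UniqueDiffOn ℝ halfSpace :=
  (𝓡∂ 3).uniqueDiffOn

theorem mem_halfSpace {y : E3} : y ∈ halfSpace ↔ 0 ≤ y 0 := by
  rw [halfSpace, range_modelWithCornersEuclideanHalfSpace]
  rfl

theorem coord_mem_halfSpace (x : Ω) : coord x ∈ halfSpace :=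
  mem_range_self _

theorem coord_zero {x : Ω} (hx : x ∈ (𝓡∂ 3).boundary Ω) : coord x 0 = 0 := by
  have h : coord x ∈ frontier halfSpace := hx
  rw [halfSpace, frontier_range_modelWithCornersEuclideanHalfSpace] at h
  exact Eq.symm h

variable {γ : LorentzMetric N} {ι : Ω → N}

theorem localSpacetimeMetric_coord (x : Ω) (u v : E4) :
    localSpacetimeMetric γ ι x (localEmb ι x (coord x)) u v = γ.form (ι x) u v := by
  have : IsManifold (𝓡 4) 1 N := IsManifold.of_le (n := ∞) (by norm_num)
  rw [localEmb_coord]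
  exact chartForm_self γ.form (ι x) u v

theorem isInvertible_localSpacetimeMetric (x : Ω) :
    (localSpacetimeMetric γ ι x (localEmb ι x (coord x))).IsInvertible := by
  obtain ⟨b, hb⟩ := γ.signature (ι x)
  refine isInvertible_of_orthogonal (k := 4) (e := fun i ↦ (b i : E4))
    (σ := fun i ↦ if i = 3 then -1 else 1) (by simp) (fun i ↦ by split_ifs <;> norm_num) ?_
  intro i j
  exact (localSpacetimeMetric_coord x _ _).trans (hb i j)

theorem differentiableAt_localSpacetimeMetric (x : Ω) :
    DifferentiableAt ℝ (localSpacetimeMetric γ ι x) (localEmb ι x (coord x)) := by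
  rw [localEmb_coord]
  exact γ.differentiableAt_chartForm (ι x)

theorem IsSpacelikeHypersurface.contDiffWithinAt_localEmb (hι : IsSpacelikeHypersurface γ ι)
    (x : Ω) : ContDiffWithinAt ℝ ∞ (localEmb ι x) halfSpace (coord x) :=
  (contMDiffAt_iff.1 (hι.contMDiff x)).2

theorem IsSpacelikeHypersurface.push_eq_mfderiv (hι : IsSpacelikeHypersurface γ ι) (x : Ω)
    (v : E3) : push ι x v = mfderiv (𝓡∂ 3) (𝓡 4) ι x v := by
  rw [((hι.contMDiff x).mdifferentiableAt (by simp)).mfderiv]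
  rfl

theorem localMetric_coord (x : Ω) (u v : E3) :
    localMetric γ ι x (coord x) u v = γ.form (ι x) (push ι x u) (push ι x v) := by
  rw [← localSpacetimeMetric_coord]
  rfl

theorem localMetric_symm (x : Ω) (y u v : E3) :
    localMetric γ ι x y u v = localMetric γ ι x y v u := by
  simp only [localMetric, ContinuousLinearMap.bilinearComp_apply]
  exact localSpacetimeMetric_symm _ _ _ _

theorem IsSpacelikeHypersurface.localMetric_pos (hι : IsSpacelikeHypersurface γ ι) (x : Ω)
    {v : E3} (hv : v ≠ 0) : 0 < localMetric γ ι x (coord x) v v := by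
  rw [localMetric_coord, hι.push_eq_mfderiv]
  exact hι.spacelike x v hv

theorem IsSpacelikeHypersurface.isInvertible_localMetric (hι : IsSpacelikeHypersurface γ ι)
    (x : Ω) : (localMetric γ ι x (coord x)).IsInvertible :=
  isInvertible_of_pos fun _ hv ↦ hι.localMetric_pos x hv

/-- Gauss formula: the tangential part of the spacetime derivative is the intrinsic one. It lets `H`
be read off in the spacetime. -/
theorem IsSpacelikeHypersurface.koszul_localMetric (hι : IsSpacelikeHypersurface γ ι)
    (x : Ω) (u v w : E3) :
    DifferentiableWithinAt ℝ (localMetric γ ι x) halfSpace (coord x) ∧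
    koszul (localMetric γ ι x) halfSpace (coord x) u v w
      = γ.form (ι x) (spacetimeDeriv γ ι x u v) (push ι x w) := by
  have hc := hι.contDiffWithinAt_localEmb x
  -- Second derivatives stay symmetric at boundary points, these being limits of interior points of
  -- the half space.
  have hsymm : IsSymmSndFDerivWithinAt ℝ (localEmb ι x) halfSpace (coord x) :=
    hc.isSymmSndFDerivWithinAt (by simp; norm_cast) uniqueDiffOn_halfSpace
      ((𝓡∂ 3).range_subset_closure_interior (coord_mem_halfSpace x)) (coord_mem_halfSpace x)
  rw [← localSpacetimeMetric_coord]
  exact koszul_pullback (uniqueDiffOn_halfSpace _ (coord_mem_halfSpace x))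
    (differentiableAt_localSpacetimeMetric x) (localSpacetimeMetric_symm x)
    (isInvertible_localSpacetimeMetric x) (hc.differentiableWithinAt (by simp))
    ((hc.fderivWithin_right (m := 1) uniqueDiffOn_halfSpace (by norm_cast)
      (coord_mem_halfSpace x)).differentiableWithinAt one_ne_zero) hsymm u v w

/-- `spacetimeDeriv` as a bilinear map. -/
def spacetimeDerivLinear (γ : LorentzMetric N) (ι : Ω → N) (x : Ω) : E3 →ₗ[ℝ] E3 →ₗ[ℝ] E4 :=
  LinearMap.mk₂ ℝ (spacetimeDeriv γ ι x)
    (fun u u' v ↦ by simp [spacetimeDeriv, covDerivAlong, christoffel_add_left]; abel)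
    (fun c u v ↦ by simp [spacetimeDeriv, covDerivAlong, christoffel_smul_left])
    (fun u v v' ↦ by simp [spacetimeDeriv, covDerivAlong, christoffel_add_right]; abel)
    (fun c u v ↦ by simp [spacetimeDeriv, covDerivAlong, christoffel_smul_right])

/-- `secondForm` as a bilinear map. -/
def secondFormLinear (γ : LorentzMetric N) (ι : Ω → N) (τ : (x : Ω) → TangentSpace (𝓡 4) (ι x))
    (x : Ω) : E3 →ₗ[ℝ] E3 →ₗ[ℝ] ℝ :=
  (spacetimeDerivLinear γ ι x).compr₂ (-(spacetimeForm γ ι x).flip (τ x)).toLinearMap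

/-! ### Functions that vanish on the boundary -/

theorem contDiffWithinAt_localFun {f : Ω → ℝ} {x : Ω}
    (hf : ContMDiffAt (𝓡∂ 3) 𝓘(ℝ, ℝ) ∞ f x) :
    ContDiffWithinAt ℝ ∞ (localFun f x) halfSpace (coord x) :=
  (contMDiffAt_iff.1 hf).2

/-- Near `x`, the boundary of `Ω` is the boundary of the half space in the chart at `x`. -/
theorem symm_mem_boundary [IsManifold (𝓡∂ 3) ∞ Ω] {x : Ω} {y : E3}
    (hy : y ∈ (extChartAt (𝓡∂ 3) x).target) (h0 : y 0 = 0) :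
    (extChartAt (𝓡∂ 3) x).symm y ∈ (𝓡∂ 3).boundary Ω := by
  have hs : (extChartAt (𝓡∂ 3) x).symm y ∈ (chartAt (EuclideanHalfSpace 3) x).source := by
    rw [← extChartAt_source (𝓡∂ 3)]
    exact (extChartAt (𝓡∂ 3) x).map_target hy
  refine (ModelWithCorners.isBoundaryPoint_iff_of_mem_atlas (n := ∞) (by simp)
    (chart_mem_atlas _ x) hs).2 ?_
  change extChartAt (𝓡∂ 3) x ((extChartAt (𝓡∂ 3) x).symm y) ∈
    frontier (extChartAt (𝓡∂ 3) x).target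
  rw [(extChartAt (𝓡∂ 3) x).right_inv hy]
  -- A point interior to the chart target would be interior to the half space, contradicting `y 0 =
  -- 0`.
  refine ⟨subset_closure hy, fun hi ↦ ?_⟩
  have h1 : y ∈ frontier (range (𝓡∂ 3)) := by
    rw [frontier_range_modelWithCornersEuclideanHalfSpace]
    exact h0.symm
  exact h1.2 (interior_mono (extChartAt_target_subset_range x) hi)

theorem eventually_localFun_eq_zero [IsManifold (𝓡∂ 3) ∞ Ω] {f : Ω → ℝ} {x : Ω}
    (hf0 : ∀ x ∈ (𝓡∂ 3).boundary Ω, f x = 0) :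
    ∀ᶠ y in 𝓝[halfSpace] (coord x), y 0 = 0 → localFun f x y = 0 := by
  filter_upwards [extChartAt_target_mem_nhdsWithin (I := 𝓡∂ 3) x] with y hy h0
  exact hf0 _ (symm_mem_boundary hy h0)

end Bridge

/-! ### Functions vanishing on the boundary of the half space. -/

section HalfSpace

/-- The derivative of a function that vanishes on the boundary of the half space vanishes in the
tangential directions. -/
theorem fderivWithin_apply_eq_zero_of_boundary {E : Type*} [NormedAddCommGroup E] [NormedSpace ℝ E]
    {φ : E3 → E} {y v : E3} (hφ : DifferentiableWithinAt ℝ φ halfSpace y) (hy : y 0 = 0)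
    (hv : v 0 = 0) (h0 : ∀ᶠ z in 𝓝[halfSpace] y, z 0 = 0 → φ z = 0) :
    fderivWithin ℝ φ halfSpace y v = 0 := by
  -- This line stays in the boundary for `t` of both signs, so an ordinary derivative at `0` is
  -- available.
  let c : ℝ → E3 := fun t ↦ y + t • v
  have hc0 : c 0 = y := by simp [c]
  have hcz : ∀ t, c t 0 = 0 := fun t ↦ by simp [c, hy, hv]
  have hcs : ∀ t, c t ∈ halfSpace := fun t ↦ mem_halfSpace.2 (hcz t).ge
  have hc : HasDerivAt c v 0 := by
    simpa [c] using ((hasDerivAt_id (0 : ℝ)).smul_const v).const_add y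
  have h1 : HasDerivAt (φ ∘ c) (fderivWithin ℝ φ halfSpace y v) 0 := by
    have hφ' : HasFDerivWithinAt φ (fderivWithin ℝ φ halfSpace y) halfSpace (c 0) := by
      rw [hc0]; exact hφ.hasFDerivWithinAt
    exact hφ'.comp_hasDerivAt 0 hc (Filter.Eventually.of_forall hcs)
  have h2 : φ ∘ c =ᶠ[𝓝 0] fun _ ↦ 0 := by
    have ht : Filter.Tendsto c (𝓝 0) (𝓝[halfSpace] y) := by
      refine tendsto_nhdsWithin_iff.2 ⟨?_, Filter.Eventually.of_forall hcs⟩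
      simpa only [hc0] using hc.continuousAt.tendsto
    filter_upwards [ht.eventually h0] with t h
    exact h (hcz t)
  exact h1.unique ((hasDerivAt_const (0 : ℝ) (0 : E)).congr_of_eventuallyEq h2)

/-- The first-order lemma applies twice: it shows that `z ↦ dF_z v` vanishes on the boundary near
`y`, and then that the derivative of this function along `u` is zero. -/
theorem fderivWithin_fderivWithin_eq_zero_of_boundary {F : E3 → ℝ} {y u v : E3}
    (hF : ContDiffWithinAt ℝ ∞ F halfSpace y) (hy : y 0 = 0)
    (hu : u 0 = 0) (hv : v 0 = 0) (h0 : ∀ᶠ z in 𝓝[halfSpace] y, z 0 = 0 → F z = 0) :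
    fderivWithin ℝ (fderivWithin ℝ F halfSpace) halfSpace y u v = 0 := by
  have hys : y ∈ halfSpace := mem_halfSpace.2 hy.ge
  have hd : DifferentiableWithinAt ℝ (fderivWithin ℝ F halfSpace) halfSpace y :=
    (hF.fderivWithin_right (m := 1) uniqueDiffOn_halfSpace (by norm_cast)
      hys).differentiableWithinAt one_ne_zero
  have h1 := (hd.hasFDerivWithinAt.clm_apply (hasFDerivWithinAt_const v y halfSpace))
  have h2 := h1.fderivWithin (uniqueDiffOn_halfSpace y hys)
  have h3 : fderivWithin ℝ (fun z ↦ fderivWithin ℝ F halfSpace z v) halfSpace y u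
      = fderivWithin ℝ (fderivWithin ℝ F halfSpace) halfSpace y u v := by
    rw [h2]
    simp
  rw [← h3]
  refine fderivWithin_apply_eq_zero_of_boundary h1.differentiableWithinAt hy hu ?_
  have hF1 : ∀ᶠ z in 𝓝[halfSpace] y, DifferentiableWithinAt ℝ F halfSpace z := by
    have := (hF.of_le (m := 1) (by norm_cast)).eventually (by simp)
    rw [insert_eq_of_mem hys] at this
    filter_upwards [this] with z hz
    exact hz.differentiableWithinAt one_ne_zero
  filter_upwards [hF1, eventually_eventually_nhdsWithin.2 h0] with z hz hz0 hz'
  exact fderivWithin_apply_eq_zero_of_boundary hz hz' hv hz0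

end HalfSpace

/-! ### Adapted frames and traces. -/

section Frames

variable {B : E3 →L[ℝ] E3 →L[ℝ] ℝ} {e : Fin 2 → E3} {ν : E3}

theorem IsBoundaryFrame.isOrthonormalFor_cons (he : IsBoundaryFrame B e)
    (hν : IsOutwardUnitNormal B ν) (hB : ∀ u v, B u v = B v u) :
    IsOrthonormalFor B ![ν, e 0, e 1] := by
  have h := he.orthonormal
  have hn := fun a ↦ hν.normal (e a) (he.tangent a)
  intro i j
  fin_cases i <;> fin_cases j <;> simp [h _ _, hν.unit, hn, hB _ ν]

theorem IsBoundaryFrame.eq_sum (he : IsBoundaryFrame B e) (hν : IsOutwardUnitNormal B ν)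
    (hB : ∀ u v, B u v = B v u) (v : E3) :
    v = B v ν • ν + B v (e 0) • e 0 + B v (e 1) • e 1 := by
  have h := (he.isOrthonormalFor_cons hν hB).sum_smul_eq (by simp) v
  rw [Fin.sum_univ_three] at h
  exact h.symm

/-- The trace over the boundary does not depend on the frame. -/
theorem IsBoundaryFrame.sum_apply_eq (he : IsBoundaryFrame B e) {e' : Fin 2 → E3}
    (he' : IsBoundaryFrame B e') (hν : IsOutwardUnitNormal B ν) (hB : ∀ u v, B u v = B v u)
    (T : E3 →ₗ[ℝ] E3 →ₗ[ℝ] ℝ) : ∑ a, T (e a) (e a) = ∑ a, T (e' a) (e' a) := by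
  -- Adjoining `ν` completes both frames; the full traces agree and the `ν` term cancels.
  have h := (he.isOrthonormalFor_cons hν hB).sum_apply_eq (he'.isOrthonormalFor_cons hν hB) hB
    (by simp) T
  simp only [Fin.sum_univ_three, Fin.sum_univ_two, Matrix.cons_val] at h ⊢
  linarith

theorem apply_eq_sum_single (T : E3 →ₗ[ℝ] E3 →ₗ[ℝ] ℝ) (v w : E3) :
    T v w = ∑ i, ∑ j, v i * w j * T (EuclideanSpace.single i 1) (EuclideanSpace.single j 1) := by
  have h : ∀ v : E3, v = ∑ i, v i • EuclideanSpace.single i (1 : ℝ) := fun v ↦ by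
    ext j
    simp [Finset.sum_apply, Pi.single_apply]
  conv_lhs => rw [h v, h w]
  simp only [map_sum, map_smul, LinearMap.sum_apply, LinearMap.smul_apply, smul_eq_mul,
    Finset.mul_sum]
  rw [Finset.sum_comm]
  refine Finset.sum_congr rfl fun i _ ↦ Finset.sum_congr rfl fun j _ ↦ ?_
  ring

/-- The trace in coordinates of a bilinear form, with respect to `g^{ij} - c u^i u^j`. -/
theorem IsOrthonormalFor.sum_sharp_mul_eq {b : Fin 3 → E3} (hb : IsOrthonormalFor B b)
    (hB : B.IsInvertible) (T : E3 →ₗ[ℝ] E3 →ₗ[ℝ] ℝ) (u : E3) (c : ℝ) :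
    ∑ i, ∑ j, (sharp B (EuclideanSpace.proj j) i - u i * u j / c)
        * T (EuclideanSpace.single i 1) (EuclideanSpace.single j 1)
      = ∑ k, T (b k) (b k) - T u u / c := by
  have h : ∑ k, T (b k) (b k) = ∑ i, ∑ j, (∑ k, b k i * b k j)
      * T (EuclideanSpace.single i 1) (EuclideanSpace.single j 1) := by
    simp_rw [apply_eq_sum_single T (b _), Finset.sum_mul]
    rw [Finset.sum_comm]
    exact Finset.sum_congr rfl fun i _ ↦ Finset.sum_comm
  rw [h, apply_eq_sum_single T u u, Finset.sum_div, ← Finset.sum_sub_distrib]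
  refine Finset.sum_congr rfl fun i _ ↦ ?_
  rw [Finset.sum_div, ← Finset.sum_sub_distrib]
  refine Finset.sum_congr rfl fun j _ ↦ ?_
  -- In an orthonormal frame, `g^{ij} = ∑_k b_k^i b_k^j`.
  rw [sharp_eq_sum hB hb (by simp)]
  simp [Fin.sum_univ_three]
  ring

end Frames

/-! ### The null-frame identity and the boundary computation. -/

section Boundary

/-- The normal components of a vector in an orthonormal frame of a Lorentzian plane, compared with
its components along two null normals. -/
theorem sq_sub_sq_eq_of_null {A : E4 →L[ℝ] E4 →L[ℝ] ℝ}
    {b : Fin 4 → E4} (hb : ∀ i j, A (b i) (b j) = if i = j then (if i = 3 then -1 else 1) else 0)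
    {l n : E4} (hll : A l l = 0) (hnn : A n n = 0) (hln : A l n = -1)
    (hl0 : A l (b 0) = 0) (hl1 : A l (b 1) = 0) (hn0 : A n (b 0) = 0) (hn1 : A n (b 1) = 0)
    (K : E4) : A K (b 2) ^ 2 - A K (b 3) ^ 2 = -2 * (A K l * A K n) := by
  have hexp : ∀ v, A v (b 0) = 0 → A v (b 1) = 0 → v = A v (b 2) • b 2 - A v (b 3) • b 3 := by
    intro v h0 h1
    have h := sum_smul_eq_of_orthogonal (σ := fun i ↦ if i = 3 then -1 else 1) (by simp)
      (fun i ↦ by split_ifs <;> norm_num) hb v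
    simp [Fin.sum_univ_four, h0, h1] at h
    rw [sub_eq_add_neg]
    exact h.symm
  have h22 : A (b 2) (b 2) = 1 := by simp [hb]
  have h33 : A (b 3) (b 3) = -1 := by simp [hb]
  have h23 : A (b 2) (b 3) = 0 := by simp [hb]
  have h32 : A (b 3) (b 2) = 0 := by simp [hb]
  have hl := hexp l hl0 hl1
  have hn := hexp n hn0 hn1
  generalize A l (b 2) = α at hl
  generalize A l (b 3) = β at hl
  generalize A n (b 2) = α' at hn
  generalize A n (b 3) = β' at hn
  subst hl hn
  simp only [map_sub, map_smul, sub_apply, smul_apply, smul_eq_mul, h22, h33, h23, h32]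
    at hll hnn hln ⊢
  -- Nullity gives `(αα')² = (ββ')²`, and the pairing gives `αα' = ββ' - 1`.
  have h1 : β * β' = 1 / 2 := by
    have hs : (α * α') ^ 2 = (β * β') ^ 2 := by
      have h1 : α ^ 2 = β ^ 2 := by linarith
      have h2 : α' ^ 2 = β' ^ 2 := by linarith
      rw [mul_pow, mul_pow, h1, h2]
    nlinarith
  have h2 : α * α' = -(1 / 2) := by linarith
  have h3 : α * β' + β * α' = 0 := by
    have h1' : α ^ 2 = β ^ 2 := by linarith
    have h2' : α' ^ 2 = β' ^ 2 := by linarith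
    have : (α * β' + β * α') ^ 2 = 0 := by
      have e1 : (α * β' + β * α') ^ 2
        = α ^ 2 * β' ^ 2 + β ^ 2 * α' ^ 2 + 2 * (α * α') * (β * β') := by ring
      have e2 : α ^ 2 * β' ^ 2 = (α * α') ^ 2 := by rw [← h2']; ring
      have e3 : β ^ 2 * α' ^ 2 = (α * α') ^ 2 := by rw [← h1']; ring
      rw [e1, e2, e3, h2, h1]
      norm_num
    exact pow_eq_zero_iff two_ne_zero |>.1 this
  generalize A K (b 2) = p
  generalize A K (b 3) = q
  linear_combination (2 * p ^ 2) * h2 + (2 * q ^ 2) * h1 - (2 * p * q) * h3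

/-- The squares of the two sides differ by `(a H - r P)²`. The right side is nonnegative because
`|a| ≤ r` and `|P| ≤ H`. -/
theorem sqrt_sq_sub_sq_le {H P a r : ℝ} (hH : 0 < H) (hr : 0 < r) (hr2 : r ^ 2 = 1 + a ^ 2)
    (hHP : P ^ 2 ≤ H ^ 2) : √(H ^ 2 - P ^ 2) ≤ r * H - a * P := by
  have h1 : a * P ≤ r * H := by
    refine le_of_sq_le_sq ?_ (by positivity)
    nlinarith [sq_nonneg a, sq_nonneg P, mul_le_mul_of_nonneg_left hHP (sq_nonneg a)]
  rw [Real.sqrt_le_left (by linarith)]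
  nlinarith [sq_nonneg (a * H - r * P)]

variable {G : E3 → E3 →L[ℝ] E3 →L[ℝ] ℝ} {F : E3 → ℝ} {y : E3}

/-- At a boundary point, where `df = a ⟨ν, ·⟩`, Jang's equation gives
`H̄ - ⟨X, ν̄⟩ = √(1 + a²) H - a P`. -/
theorem boundaryMeanCurvature_graph_sub
    (hG : DifferentiableWithinAt ℝ G halfSpace y) (hsymm : ∀ z u v, G z u v = G z v u)
    (hpos : ∀ v, v ≠ 0 → 0 < G y v v) (hF : ContDiffWithinAt ℝ ∞ F halfSpace y) (hy : y 0 = 0)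
    (hF0 : ∀ᶠ z in 𝓝[halfSpace] y, z 0 = 0 → F z = 0)
    (p : E3 →ₗ[ℝ] E3 →ₗ[ℝ] ℝ)
    (hJang : ∑ i : Fin 3, ∑ j : Fin 3, (sharp (G y) (EuclideanSpace.proj j) i
        - grad G halfSpace F y i * grad G halfSpace F y j / (1 + gradSq G halfSpace F y))
      * (hess G halfSpace F y (EuclideanSpace.single i 1) (EuclideanSpace.single j 1)
          / √(1 + gradSq G halfSpace F y)
        - p (EuclideanSpace.single i 1) (EuclideanSpace.single j 1)) = 0)
    {e ebar : Fin 2 → E3} {ν νbar : E3} (he : IsBoundaryFrame (G y) e)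
    (hν : IsOutwardUnitNormal (G y) ν)
    (hebar : IsBoundaryFrame (graphMetric G halfSpace F y) ebar)
    (hνbar : IsOutwardUnitNormal (graphMetric G halfSpace F y) νbar)
    {b : Fin 3 → E3} (hb : IsOrthonormalFor (graphMetric G halfSpace F y) b) :
    ∃ a : ℝ, boundaryMeanCurvature (graphMetric G halfSpace F) y ebar νbar
        - graphMetric G halfSpace F y (jangVector G halfSpace (fun u v ↦ p u v) F y b) νbar
      = √(1 + a ^ 2) * boundaryMeanCurvature G y e ν - a * ∑ i, p (e i) (e i) := by
  have hys : y ∈ halfSpace := mem_halfSpace.2 hy.ge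
  have hs := uniqueDiffOn_halfSpace y hys
  have hB : (G y).IsInvertible := isInvertible_of_pos hpos
  have hF' : DifferentiableWithinAt ℝ (fderivWithin ℝ F halfSpace) halfSpace y :=
    (hF.fderivWithin_right (m := 1) uniqueDiffOn_halfSpace (by norm_cast)
      hys).differentiableWithinAt one_ne_zero
  have hdF : ∀ v : E3, v 0 = 0 → fderivWithin ℝ F halfSpace y v = 0 := fun v hv ↦
    fderivWithin_apply_eq_zero_of_boundary (hF.differentiableWithinAt (by simp)) hy hv hF0
  have hddF : ∀ v : E3, v 0 = 0 →
      fderivWithin ℝ (fderivWithin ℝ F halfSpace) halfSpace y v v = 0 := fun v hv ↦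
    fderivWithin_fderivWithin_eq_zero_of_boundary hF hy hv hv hF0
  obtain ⟨a, ha⟩ : ∃ a, a = fderivWithin ℝ F halfSpace y ν := ⟨_, rfl⟩
  have hdFν : fderivWithin ℝ F halfSpace y = a • G y ν := by
    ext v
    conv_lhs => rw [he.eq_sum hν (hsymm y) v]
    simp only [map_add, map_smul, hdF _ (he.tangent _), ← ha, hsymm y v]
    simp [mul_comm]
  set r := √(1 + a ^ 2) with hr
  have hr0 : 0 < r := Real.sqrt_pos.2 (by positivity)
  have hr2 : r ^ 2 = 1 + a ^ 2 := Real.sq_sqrt (by positivity)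
  have hνbar' : νbar = r⁻¹ • ν := by
    have h0 : ∀ v : E3, v 0 = 0 → G y νbar v = 0 := fun v hv ↦ by
      have := hνbar.normal v hv
      rwa [graphMetric_apply, hdF v hv, mul_zero, add_zero] at this
    have h1 := he.eq_sum hν (hsymm y) νbar
    rw [h0 _ (he.tangent 0), h0 _ (he.tangent 1), zero_smul, zero_smul, add_zero, add_zero] at h1
    generalize G y νbar ν = c at h1
    have h2 := hνbar.unit
    have h3 := hνbar.outward
    rw [h1] at h2 h3
    -- Both normals point outward, which selects the positive root of `(c r)² = 1`.
    have hc : 0 < c := by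
      have h4 : c * ν 0 < 0 := by simpa using h3
      nlinarith [hν.outward]
    rw [graphMetric_apply, hdFν] at h2
    simp only [map_smul, smul_apply, smul_eq_mul, hν.unit] at h2
    have h5 : (c * r) ^ 2 = 1 := by rw [mul_pow, hr2]; linarith
    have h6 : c * r = 1 := by
      nlinarith [mul_pos hc hr0]
    rw [h1, eq_inv_of_mul_eq_one_left h6]
  have hgpos : ∀ v, v ≠ 0 → 0 < graphMetric G halfSpace F y v v := fun v hv ↦ by
    rw [graphMetric_apply]
    nlinarith [hpos v hv, mul_self_nonneg (fderivWithin ℝ F halfSpace y v)]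
  have hgsymm : ∀ u v, graphMetric G halfSpace F y u v = graphMetric G halfSpace F y v u :=
    fun u v ↦ by rw [graphMetric_apply, graphMetric_apply, hsymm, mul_comm]
  have hebar' : IsBoundaryFrame (G y) ebar := ⟨fun i j ↦ by
    have := hebar.orthonormal i j
    rwa [graphMetric_apply, hdF _ (hebar.tangent i), zero_mul, add_zero] at this, hebar.tangent⟩
  -- the mean curvature of the boundary of the graph
  have hHbar : boundaryMeanCurvature (graphMetric G halfSpace F) y ebar νbar
      = r⁻¹ * boundaryMeanCurvature G y e ν := by
    have h1 : ∑ i, G y (christoffel G halfSpace y (e i) (e i)) ν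
        = ∑ i, G y (christoffel G halfSpace y (ebar i) (ebar i)) ν :=
      he.sum_apply_eq hebar' hν (hsymm y)
        ((christoffelLinear G halfSpace y).compr₂ ((G y).flip ν).toLinearMap)
    rw [boundaryMeanCurvature, boundaryMeanCurvature, h1, mul_neg, Finset.mul_sum]
    congr 1
    refine Finset.sum_congr rfl fun i _ ↦ ?_
    rw [apply_christoffel (isInvertible_of_pos hgpos),
      koszul_graphMetric hs hG hF' _ (hdF _ (hebar.tangent i)) (hddF _ (hebar.tangent i)),
      ← apply_christoffel hB, hνbar', map_smul, smul_eq_mul]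
  -- the normal component of the Jang vector
  have hX : graphMetric G halfSpace F y (jangVector G halfSpace (fun u v ↦ p u v) F y b) νbar
      = a * r⁻¹ ^ 3 * hess G halfSpace F y ν ν - a * r⁻¹ ^ 2 * p ν ν := by
    have h1 : hNormal G halfSpace F y νbar = a * r⁻¹ ^ 3 * hess G halfSpace F y ν ν := by
      rw [hνbar']
      exact hNormal_apply hs hys hG hF' hB (hsymm y) hν.unit hdFν
    have h2 : pNormal G halfSpace (fun u v ↦ p u v) F y νbar = a * r⁻¹ ^ 2 * p ν ν := by
      simp only [pNormal, graphLift, downNormal, gradSq_eq_of_fderivWithin_eq hB hν.unit hdFν,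
        grad_eq_of_fderivWithin_eq hB hdFν, hνbar', Prod.smul_fst, map_smul, LinearMap.smul_apply,
        smul_eq_mul, ← hr]
      ring
    rw [← h1, ← h2]
    have h3 : ∀ L : E3 →ₗ[ℝ] ℝ, ∑ i, L (b i) * graphMetric G halfSpace F y (b i) νbar = L νbar := by
      intro L
      conv_rhs => rw [← hb.sum_smul_eq (by simp) νbar]
      simp only [map_sum, map_smul, smul_eq_mul]
      exact Finset.sum_congr rfl fun i _ ↦ by rw [hgsymm νbar, mul_comm]
    -- The covector `h_{i4} - p_{i4}`: its pairing with `ν̄` through the frame `b` is its value at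
    -- `ν̄`.
    let L : E3 →ₗ[ℝ] ℝ := ((productMetric G (y, F y) (covDeriv (productMetric G)
      (halfSpace ×ˢ univ) (downNormal G halfSpace F) (y, F y)
        (downNormal G halfSpace F (y, F y)))).comp
          ((ContinuousLinearMap.id ℝ E3).prod (fderivWithin ℝ F halfSpace y))).toLinearMap
      - p.flip (downNormal G halfSpace F (y, F y)).1
    rw [jangVector, map_sum, sum_apply]
    simp only [map_smul, smul_apply, smul_eq_mul]
    exact h3 L
  -- Jang's equation
  have hJ : ∑ i, (hess G halfSpace F y (e i) (e i) / r - p (e i) (e i))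
      + (hess G halfSpace F y ν ν / r - p ν ν) / r ^ 2 = 0 := by
    have h1 := (he.isOrthonormalFor_cons hν (hsymm y)).sum_sharp_mul_eq hB
      (r⁻¹ • hessLinear G halfSpace F y - p) (a • ν) (1 + a ^ 2)
    simp only [gradSq_eq_of_fderivWithin_eq hB hν.unit hdFν,
        grad_eq_of_fderivWithin_eq hB hdFν, ← hr] at hJang
    have h2 : ∀ u v, (r⁻¹ • hessLinear G halfSpace F y - p) u v
        = hess G halfSpace F y u v / r - p u v := fun u v ↦ by
      simp [hessLinear, div_eq_inv_mul]
    simp only [map_smul, LinearMap.smul_apply, h2] at h1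
    rw [hJang, ← hr2] at h1
    simp only [Fin.sum_univ_three, Matrix.cons_val, smul_eq_mul] at h1
    rw [Fin.sum_univ_two]
    have h3 : a ^ 2 = r ^ 2 - 1 := by linarith
    -- Since `1 - a² / r² = 1 / r²`, the `νν` term of Jang's equation has weight `1 / r²`.
    have h4 : a * (a * (hess G halfSpace F y ν ν / r - p ν ν)) / r ^ 2
        = (hess G halfSpace F y ν ν / r - p ν ν)
          - (hess G halfSpace F y ν ν / r - p ν ν) / r ^ 2 := by
      rw [← mul_assoc, ← sq, h3]
      field_simp
    rw [h4] at h1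
    linarith
  -- On tangential vectors the Hessian reduces to `-dF(Γ(e, e))`, and `dF = a⟨ν, ·⟩`.
  have hH : ∑ i, hess G halfSpace F y (e i) (e i) = a * boundaryMeanCurvature G y e ν := by
    rw [boundaryMeanCurvature, mul_neg, Finset.mul_sum, ← Finset.sum_neg_distrib]
    refine Finset.sum_congr rfl fun i _ ↦ ?_
    rw [hess, hddF _ (he.tangent i), hdFν, smul_apply, hsymm y ν, smul_eq_mul, zero_sub]
  refine ⟨a, ?_⟩
  rw [hHbar, hX, ← hr]
  rw [Finset.sum_sub_distrib, ← Finset.sum_div, hH] at hJ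
  generalize boundaryMeanCurvature G y e ν = H at *
  generalize hess G halfSpace F y ν ν = h at *
  generalize p ν ν = q at *
  generalize ∑ i, p (e i) (e i) = P at *
  -- Jang's equation times `a` removes the normal term of `⟨X, ν̄⟩`, with no division by `a`, which
  -- may vanish.
  have h5 : a * (a * H / r - P + (h / r - q) / r ^ 2) = 0 := by rw [hJ, mul_zero]
  have h6 : r * H = (1 + a ^ 2) * H / r := by rw [← hr2]; field_simp
  rw [h6]
  have h7 : r⁻¹ * H - (a * r⁻¹ ^ 3 * h - a * r⁻¹ ^ 2 * q)
      = H / r - a * ((h / r - q) / r ^ 2) := by field_simp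
  rw [h7]
  linear_combination (-1 : ℝ) * h5

end Boundary

end JangBoundary

end

open JangBoundary

/-! ### The estimate at a boundary point. -/

theorem lemma6
    {N : Type*} [TopologicalSpace N] [ChartedSpace E4 N] [IsManifold (𝓡 4) ∞ N]
    {Ω : Type*} [TopologicalSpace Ω] [ChartedSpace (EuclideanHalfSpace 3) Ω]
    [IsManifold (𝓡∂ 3) ∞ Ω]
    -- the spacetime, the spacelike hypersurface and its timelike unit normal
    (γ : LorentzMetric N) (ι : Ω → N) (hι : IsSpacelikeHypersurface γ ι)
    (τ : (x : Ω) → TangentSpace (𝓡 4) (ι x)) (hτ : IsTimelikeUnitNormal γ ι τ)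
    -- the solution of Jang's equation, near the boundary, with zero boundary values
    (U : Set Ω) (hU : IsOpen U) (hUb : (𝓡∂ 3).boundary Ω ⊆ U)
    (f : Ω → ℝ) (hf : ContMDiffOn (𝓡∂ 3) 𝓘(ℝ, ℝ) ∞ f U)
    (hJang : ∀ x ∈ U, JangEquationAt γ ι τ f x)
    (hf0 : ∀ x ∈ (𝓡∂ 3).boundary Ω, f x = 0)
    -- a point of the boundary
    (x : Ω) (hx : x ∈ (𝓡∂ 3).boundary Ω)
    -- the metrics `g` and `ḡ` in the chart at `x`
    (g gbar : E3 → E3 →L[ℝ] E3 →L[ℝ] ℝ) (hg : g = localMetric γ ι x)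
    (hgbar : gbar = graphMetric g halfSpace (localFun f x))
    -- frames and outward unit normals of the boundary for `g` and `ḡ`
    (e : Fin 2 → E3) (he : IsBoundaryFrame (g (coord x)) e)
    (ν : E3) (hν : IsOutwardUnitNormal (g (coord x)) ν)
    (ebar : Fin 2 → E3) (hebar : IsBoundaryFrame (gbar (coord x)) ebar)
    (νbar : E3) (hνbar : IsOutwardUnitNormal (gbar (coord x)) νbar)
    -- the vector `X`
    (b : Fin 3 → E3) (hb : IsOrthonormalFor (gbar (coord x)) b)
    (X : E3) (hX : X = jangVector g halfSpace (secondForm γ ι τ x) (localFun f x) (coord x) b)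
    -- null normals of the boundary in the spacetime
    (l n : TangentSpace (𝓡 4) (ι x)) (hln : IsNullNormalPair γ ι x l n)
    -- the mean curvatures, the trace of `p` on the boundary, and `ρ`, `μ`
    (H Hbar P ρ μ : ℝ)
    (hH : H = boundaryMeanCurvature g (coord x) e ν)
    (hHbar : Hbar = boundaryMeanCurvature gbar (coord x) ebar νbar)
    (hP : P = ∑ a, secondForm γ ι τ x (e a) (e a))
    (hρ : ρ = nullRho γ ι x e l) (hμ : μ = nullMu γ ι x e n)
    -- `H > 0`, and the mean curvature vector of the boundary is spacelike
    (hHpos : 0 < H) (hρμ : 0 < ρ * μ) :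
    Hbar - gbar (coord x) X νbar ≥ √(H ^ 2 - P ^ 2) ∧
      √(H ^ 2 - P ^ 2) = √(8 * ρ * μ) ∧ H ^ 2 - P ^ 2 = 8 * ρ * μ := by

  have hdiff : DifferentiableWithinAt ℝ (localMetric γ ι x) halfSpace (coord x) :=
    (hι.koszul_localMetric x 0 0 0).1
  have hkos := fun u v w ↦ (hι.koszul_localMetric x u v w).2
  have hinv := hι.isInvertible_localMetric x
  subst hgbar hg hX hρ hμ
  obtain ⟨a, ha⟩ := boundaryMeanCurvature_graph_sub hdiff (localMetric_symm x)
    (fun v hv ↦ hι.localMetric_pos x hv)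
    (contDiffWithinAt_localFun (hf.contMDiffAt (hU.mem_nhds (hUb hx)))) (coord_zero hx)
    (eventually_localFun_eq_zero hf0) (secondFormLinear γ ι τ x) (hJang x (hUb hx)) he hν hebar
    hνbar hb
  rw [← hH, ← hHbar] at ha
  have hP' : ∑ i, secondFormLinear γ ι τ x (e i) (e i) = P := hP.symm
  rw [hP'] at ha
  have hsq : H ^ 2 - P ^ 2 = 8 * nullRho γ ι x e l * nullMu γ ι x e n := by
    let t : E4 := τ x
    -- Only the part of `K` normal to the boundary matters: `ν`, `τ`, `l` and `n` are all orthogonal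
    -- to the boundary.
    let K : E4 := ∑ a, spacetimeDeriv γ ι x (e a) (e a)
    have hA : ∀ u v, spacetimeForm γ ι x u v = spacetimeForm γ ι x v u := γ.form_symm (ι x)
    have hτn : ∀ v, spacetimeForm γ ι x t (push ι x v) = 0 := fun v ↦ by
      rw [hι.push_eq_mfderiv]
      exact hτ.normal x v
    have hgp : ∀ u v, spacetimeForm γ ι x (push ι x u) (push ι x v)
        = localMetric γ ι x (coord x) u v := fun u v ↦ (localMetric_coord x u v).symm
    have hframe := sq_sub_sq_eq_of_null (A := spacetimeForm γ ι x)
      (b := ![push ι x (e 0), push ι x (e 1), push ι x ν, t]) (l := l) (n := n) ?_ hln.null_l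
      hln.null_n hln.pairing (hln.normal_l _ (he.tangent 0)) (hln.normal_l _ (he.tangent 1))
      (hln.normal_n _ (he.tangent 0)) (hln.normal_n _ (he.tangent 1)) K
    · have hKν : spacetimeForm γ ι x K (push ι x ν) = -H := by
        rw [hH, boundaryMeanCurvature, neg_neg, map_sum, sum_apply]
        refine Finset.sum_congr rfl fun i _ ↦ ?_
        rw [apply_christoffel hinv, hkos]
        rfl
      have hKτ : spacetimeForm γ ι x K t = -P := by
        rw [hP, map_sum, sum_apply, ← Finset.sum_neg_distrib]
        refine Finset.sum_congr rfl fun i _ ↦ ?_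
        rw [secondForm, neg_neg]
        rfl
      have h1 : nullRho γ ι x e l = -spacetimeForm γ ι x K l / 2 := rfl
      have h2 : nullMu γ ι x e n = spacetimeForm γ ι x K n / 2 := rfl
      simp only [Matrix.cons_val] at hframe
      rw [hKν, hKτ] at hframe
      rw [h1, h2]
      linarith
    · have htt : spacetimeForm γ ι x t t = -1 := hτ.unit x
      have hνe := fun a ↦ hν.normal (e a) (he.tangent a)
      have hoe := he.orthonormal
      intro i j
      fin_cases i <;> fin_cases j <;>
        simp [hgp, hoe _ _, hν.unit, hνe, localMetric_symm x _ _ ν, hA _ t, hτn, htt]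
  refine ⟨?_, by rw [hsq], hsq⟩
  refine le_of_le_of_eq ?_ ha.symm
  -- The required `P² ≤ H²` follows from `H² - P² = 8ρμ` and `ρμ > 0`.
  exact sqrt_sq_sub_sq_le hHpos (Real.sqrt_pos.2 (by positivity)) (Real.sq_sqrt (by positivity))
    (by nlinarith)
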